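/- Throughout, C*-algebras are unital, $\otimes$ between C*-algebras is the minimal tensor product, $\mathbb{T}$ is the unit circle, $z\in C(\mathbb{T})$ is the coordinate function, and $\Delta_{\mathbb{T}}:C(\mathbb{T})\to C(\mathbb{T})\otimes C(\mathbb{T})$, $z\mapsto z\otimes z$. Fix $\zeta\in\mathbb{T}$. *Braided tensor product.* Let $C(\mathbb{T}^2_\zeta)$ be the universal C*-algebra generated by unitaries $U,V$ with $VU=\zeta UV$, and let $\iota_1,\iota_2:C(\mathbb{T})\to C(\mathbb{T}^2_\zeta)$ be given by $\iota_1(z)=U$, $\iota_2(z)=V$. For C*-algebras $X,Y$ with coactions $\rho^X:X\to X\otimes C(\mathbb{T})$, $\rho^Y:Y\to Y\otimes C(\mathbb{T})$, define *-homomorphisms $j_1:X\to X\otimes Y\otimes C(\mathbb{T}^2_\zeta)$ and $j_2:Y\to X\otimes Y\otimes C(\mathbb{T}^2_\zeta)$ by $j_1(x)=x\otimes 1\otimes U^k$ if $\rho^X(x)=x\otimes z^k$ and $j_2(y)=1\otimes y\otimes V^l$ if $\rho^Y(y)=y\otimes z^l$. Then $X\boxtimes_\zeta Y$ is the C*-subalgebra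 generated by $j_1(X)\cup j_2(Y)$, which is the closed linear span of $j_1(X)j_2(Y)$. *The braided free unitary quantum group.* Let $n\ge 0$ and let $F\in GL(n,\mathbb{C})$, with inverse $(F^{ij})$, be admissible: integers $d_1,\dots,d_n$, $d'_1,\dots,d'_n$ and $d$ are given such that $F_{ij}=0=F^{ji}$ whenever $-d_j+d\neq d'_i$. Let $A=C(U_\zeta^+(F))$ be the universal unital C*-algebra generated by elements $u_{ij}$ ($1\le i,j\le n$) subject to the relations that $u=(u_{ij})$ and $F\overline{u}_\zeta F^{-1}$ are unitary, where $\overline{u}_\zeta=(\zeta^{d_i(d_j-d_i)}u_{ij}^*)_{ij}$. It carries the coaction $\rho^A:A\to A\otimes C(\mathbb{T})$, $u_{ij}\mapsto u_{ij}\otimes z^{d_j-d_i}$, while $C(\mathbb{T})$ carries the coaction $\Delta_{\mathbb{T}}$. *The bosonization.* Put $B=C(U_\zeta^+(F)\rtimes\mathbb{T})=C(\mathbb{T})\boxtimes_\zeta A$. Its comultiplication is $\Delta_B=\psi\circ(\mathrm{id}\boxtimes_\zeta\Delta_A):B\to B\otimes B$, where - $A\boxtimes_\zeta A$ carries the coaction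 of $C(\mathbb{T})$ for which $j_1,j_2:A\to A\boxtimes_\zeta A$ are equivariant; - $\Delta_A:A\to A\boxtimes_\zeta A$ is the *-homomorphism with $\Delta_A(u_{ij})=\sum_k j_1(u_{ik})j_2(u_{kj})$; - $\mathrm{id}\boxtimes_\zeta\Delta_A:C(\mathbb{T})\boxtimes_\zeta A\to C(\mathbb{T})\boxtimes_\zeta A\boxtimes_\zeta A$ is the *-homomorphism with $j_1(x)j_2(a)\mapsto j_1(x)j_2(\Delta_A(a))$, where $C(\mathbb{T})\boxtimes_\zeta A\boxtimes_\zeta A=C(\mathbb{T})\boxtimes_\zeta(A\boxtimes_\zeta A)$; - $\psi:C(\mathbb{T})\boxtimes_\zeta A\boxtimes_\zeta A\to B\otimes B$ is the *-homomorphism that sends $x\in C(\mathbb{T})$ in the first leg to $(j_1\otimes j_1)\Delta_{\mathbb{T}}(x)$, $a\in A$ in the second leg to $(j_2\otimes j_1)\rho^A(a)$, and $b\in A$ in the third leg to $1\otimes j_2(b)$. Let $t=(t_{ij})\in M_n(B)$ with $t_{ij}=j_1(z^{d_i})j_2(u_{ij})$, let $\overline{t}=(t_{ij}^*)$, and let $z\oplus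 t\in M_{1+n}(B)$ be the block diagonal matrix with blocks $j_1(z)$ and $t$. **Corollary.** All *-homomorphisms in the definition of $\Delta_B$ exist (they are determined by the listed equations), and $(B,z\oplus t)$, with comultiplication $\Delta_B$, is a compact matrix quantum group; that is, for $w=z\oplus t$, the *-algebra generated by the entries $w_{ij}$ is dense in $B$, $\Delta_B(w_{ij})=\sum_k w_{ik}\otimes w_{kj}$, and the matrices $w$ and $\overline{w}=(w_{ij}^*)$ are invertible. Moreover, $t$ is a unitary representation of $(B,\Delta_B)$: it is a unitary matrix and $\Delta_B(t_{ij})=\sum_k t_{ik}\otimes t_{kj}$. Finally, $\overline{t}=\mathrm{diag}(j_1(z^{-d_1}),\dots,j_1(z^{-d_n}))\,j_2(\overline{u}_\zeta)$, with $j_2$ applied entrywise, and $\overline{t}$ is invertible. -/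

import Mathlib

open scoped TensorProduct

noncomputable section

/-! ### C*-seminorms and their completions -/

/-- A C*-seminorm on a complex *-algebra. -/
structure CStarSeminorm (𝒜 : Type) [Ring 𝒜] [StarRing 𝒜] [Algebra ℂ 𝒜] extends
    Seminorm ℂ 𝒜 where
  mul_le' : ∀ x y, toFun (x * y) ≤ toFun x * toFun y
  sq_le' : ∀ x, toFun x * toFun x ≤ toFun (star x * x)

namespace CStarSeminorm

section Basic

variable {𝒜 : Type} [Ring 𝒜] [StarRing 𝒜] [Algebra ℂ 𝒜]

instance : CoeFun (CStarSeminorm 𝒜) (fun _ => 𝒜 → ℝ) := ⟨fun p => p.toSeminorm⟩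

theorem le_star (p : CStarSeminorm 𝒜) (x : 𝒜) : p x ≤ p (star x) := by
  by_contra h
  have h1 : p x * p x ≤ p (star x) * p x := (p.sq_le' x).trans (p.mul_le' _ _)
  have h2 : 0 ≤ p (star x) := apply_nonneg p.toSeminorm _
  nlinarith [not_le.1 h]

theorem map_star (p : CStarSeminorm 𝒜) (x : 𝒜) : p (star x) = p x :=
  le_antisymm (by simpa using p.le_star (star x)) (p.le_star x)

/-- The *-algebra `𝒜`, seen as a seminormed *-algebra through `p`. -/
def Pre (_p : CStarSeminorm 𝒜) : Type := 𝒜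

variable (p : CStarSeminorm 𝒜)

instance : Ring p.Pre := inferInstanceAs (Ring 𝒜)
instance : StarRing p.Pre := inferInstanceAs (StarRing 𝒜)
instance : Algebra ℂ p.Pre := inferInstanceAs (Algebra ℂ 𝒜)
instance [StarModule ℂ 𝒜] : StarModule ℂ p.Pre := inferInstanceAs (StarModule ℂ 𝒜)

instance : SeminormedRing p.Pre where
  __ : Ring p.Pre := inferInstance
  __ : SeminormedAddCommGroup p.Pre :=
    AddGroupSeminorm.toSeminormedAddCommGroup p.toAddGroupSeminorm
  norm_mul_le x y := p.mul_le' x y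

instance : NormedAlgebra ℂ p.Pre where
  norm_smul_le c x := (p.smul' c x).le

theorem norm_pre (x : p.Pre) : ‖x‖ = p.toFun x := rfl

instance : NormedStarGroup p.Pre where
  norm_star_le x := (p.map_star x).le

/-- The Hausdorff completion of `𝒜` with respect to `p`. -/
abbrev Completion : Type := UniformSpace.Completion p.Pre

instance : Star p.Completion := ⟨UniformSpace.Completion.map star⟩

theorem coe_star (x : p.Pre) : ((star x : p.Pre) : p.Completion) = star (x : p.Completion) :=
  (UniformSpace.Completion.map_coe
    (isometry_iff_dist_eq.2 fun x y => by
      rw [dist_eq_norm, dist_eq_norm, ← star_sub, norm_star]).uniformContinuous x).symm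

theorem continuous_star_completion : Continuous (star : p.Completion → p.Completion) :=
  UniformSpace.Completion.continuous_map

instance : StarRing p.Completion where
  star_involutive x := by
    induction x using UniformSpace.Completion.induction_on with
    | hp => exact isClosed_eq (p.continuous_star_completion.comp p.continuous_star_completion)
              continuous_id
    | ih x => rw [← coe_star, ← coe_star, star_star]
  star_mul x y := by
    induction x, y using UniformSpace.Completion.induction_on₂ with
    | hp => exact isClosed_eq (p.continuous_star_completion.comp (by fun_prop))
              ((p.continuous_star_completion.comp continuous_snd).mul
                (p.continuous_star_completion.comp continuous_fst))
    | ih x y =>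
      rw [← UniformSpace.Completion.coe_mul, ← coe_star, ← coe_star, ← coe_star,
        ← UniformSpace.Completion.coe_mul, star_mul]
  star_add x y := by
    induction x, y using UniformSpace.Completion.induction_on₂ with
    | hp => exact isClosed_eq (p.continuous_star_completion.comp (by fun_prop))
              ((p.continuous_star_completion.comp continuous_fst).add
                (p.continuous_star_completion.comp continuous_snd))
    | ih x y =>
      rw [← UniformSpace.Completion.coe_add, ← coe_star, ← coe_star, ← coe_star,
        ← UniformSpace.Completion.coe_add, star_add]

instance : NormedAlgebra ℂ p.Completion where
  norm_smul_le := norm_smul_le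

instance [StarModule ℂ 𝒜] : StarModule ℂ p.Completion where
  star_smul c x := by
    induction x using UniformSpace.Completion.induction_on with
    | hp => exact isClosed_eq (p.continuous_star_completion.comp (continuous_const_smul c))
              ((continuous_const_smul (star c)).comp p.continuous_star_completion)
    | ih x =>
      rw [← UniformSpace.Completion.coe_smul, ← coe_star, ← coe_star,
        ← UniformSpace.Completion.coe_smul, star_smul]

instance : CStarRing p.Completion where
  norm_mul_self_le x := by
    induction x using UniformSpace.Completion.induction_on with
    | hp => exact isClosed_le (by fun_prop)
              ((p.continuous_star_completion.mul continuous_id).norm)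
    | ih x =>
      rw [← coe_star, ← UniformSpace.Completion.coe_mul, UniformSpace.Completion.norm_coe,
        UniformSpace.Completion.norm_coe]
      exact p.sq_le' x

instance [StarModule ℂ 𝒜] : CStarAlgebra p.Completion where

/-- The canonical *-homomorphism of a *-algebra to its completion. -/
def toCompletion [StarModule ℂ 𝒜] : 𝒜 →⋆ₐ[ℂ] p.Completion where
  toFun x := ((show p.Pre from x : p.Pre) : p.Completion)
  map_one' := rfl
  map_mul' x y := UniformSpace.Completion.coe_mul (α := p.Pre) x y
  map_zero' := rfl
  map_add' x y := UniformSpace.Completion.coe_add (α := p.Pre) x y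
  commutes' _ := rfl
  map_star' x := p.coe_star x

theorem norm_toCompletion [StarModule ℂ 𝒜] (x : 𝒜) : ‖p.toCompletion x‖ = p x :=
  UniformSpace.Completion.norm_coe (E := p.Pre) x

theorem toCompletion_induction [StarModule ℂ 𝒜] {P : p.Completion → Prop} (x : p.Completion)
    (hP : IsClosed {x | P x}) (h : ∀ x : 𝒜, P (p.toCompletion x)) : P x :=
  UniformSpace.Completion.induction_on x hP h

section Lift

variable {p} {D : Type} [CStarAlgebra D] (φ : 𝒜 →⋆ₐ[ℂ] D)

theorem uniformContinuous_of_le (h : ∀ x, ‖φ x‖ ≤ p x) :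
    UniformContinuous (fun x : p.Pre => φ x) := by
  refine LipschitzWith.uniformContinuous (K := 1) (LipschitzWith.of_dist_le_mul fun x y => ?_)
  rw [dist_eq_norm, dist_eq_norm, NNReal.coe_one, one_mul]
  exact (congrArg norm (map_sub φ x y)).symm.le.trans (h _)

/-- The extension to the completion of a *-homomorphism dominated by `p`. -/
def lift [StarModule ℂ 𝒜] (h : ∀ x, ‖φ x‖ ≤ p x) : p.Completion →⋆ₐ[ℂ] D :=
  have hc : Continuous (UniformSpace.Completion.extension (fun x : p.Pre => φ x)) :=
    UniformSpace.Completion.continuous_extension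
  have he (x : p.Pre) : UniformSpace.Completion.extension (fun x : p.Pre => φ x)
      (x : p.Completion) = φ x :=
    UniformSpace.Completion.extension_coe (uniformContinuous_of_le φ h) x
  { toFun := UniformSpace.Completion.extension (fun x : p.Pre => φ x)
    map_one' := (he 1).trans (map_one φ)
    map_zero' := (he 0).trans (map_zero φ)
    commutes' := fun c => (he (algebraMap ℂ 𝒜 c)).trans (AlgHomClass.commutes φ c)
    map_mul' := fun x y => by
      induction x, y using UniformSpace.Completion.induction_on₂ with
      | hp => exact isClosed_eq (hc.comp (by fun_prop))
                ((hc.comp continuous_fst).mul (hc.comp continuous_snd))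
      | ih x y =>
        rw [← UniformSpace.Completion.coe_mul, he, he, he]
        exact map_mul φ _ _
    map_add' := fun x y => by
      induction x, y using UniformSpace.Completion.induction_on₂ with
      | hp => exact isClosed_eq (hc.comp (by fun_prop))
                ((hc.comp continuous_fst).add (hc.comp continuous_snd))
      | ih x y =>
        rw [← UniformSpace.Completion.coe_add, he, he, he]
        exact map_add φ _ _
    map_star' := fun x => by
      induction x using UniformSpace.Completion.induction_on with
      | hp => exact isClosed_eq (hc.comp p.continuous_star_completion) hc.star
      | ih x =>
        rw [← coe_star, he, he]
        exact StarHomClass.map_star φ _ }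

theorem lift_toCompletion [StarModule ℂ 𝒜] (h : ∀ x, ‖φ x‖ ≤ p x) (x : 𝒜) :
    lift φ h (p.toCompletion x) = φ x :=
  UniformSpace.Completion.extension_coe (uniformContinuous_of_le φ h) x

end Lift

end Basic

/-- The C*-seminorm `x ↦ ‖φ x‖` of a *-homomorphism `φ` to a C*-algebra. -/
def ofHom {𝒜 D : Type} [Ring 𝒜] [StarRing 𝒜] [Algebra ℂ 𝒜] [CStarAlgebra D] (φ : 𝒜 →⋆ₐ[ℂ] D) :
    CStarSeminorm 𝒜 where
  toSeminorm := (normSeminorm ℂ D).comp φ.toAlgHom.toLinearMap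
  mul_le' x y := (congrArg norm (map_mul φ x y)).le.trans (norm_mul_le _ _)
  sq_le' x := by
    change ‖φ x‖ * ‖φ x‖ ≤ ‖φ (star x * x)‖
    rw [map_mul, StarHomClass.map_star]
    exact CStarRing.norm_star_mul_self.symm.le

section Sup

variable {𝒜 : Type} [Ring 𝒜] [StarRing 𝒜] [Algebra ℂ 𝒜]

/-- The pointwise supremum of a pointwise bounded set of C*-seminorms. -/
def sSupOf (S : Set (CStarSeminorm 𝒜)) (hS : ∀ x, BddAbove ((fun p : CStarSeminorm 𝒜 => p x) '' S)) :
    CStarSeminorm 𝒜 where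
  toSeminorm := Seminorm.ofSMulLE (fun x => sSup ((fun p : CStarSeminorm 𝒜 => p x) '' S))
    (by
      refine le_antisymm (Real.sSup_le ?_ le_rfl) (Real.sSup_nonneg ?_)
      · rintro _ ⟨p, -, rfl⟩; exact (map_zero p.toSeminorm).le
      · rintro _ ⟨p, -, rfl⟩; exact apply_nonneg p.toSeminorm _)
    (fun x y => by
      refine Real.sSup_le ?_ (add_nonneg (Real.sSup_nonneg ?_) (Real.sSup_nonneg ?_))
      · rintro _ ⟨p, hp, rfl⟩
        exact (map_add_le_add p.toSeminorm x y).trans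
          (add_le_add (le_csSup (hS x) ⟨p, hp, rfl⟩) (le_csSup (hS y) ⟨p, hp, rfl⟩))
      · rintro _ ⟨p, -, rfl⟩; exact apply_nonneg p.toSeminorm _
      · rintro _ ⟨p, -, rfl⟩; exact apply_nonneg p.toSeminorm _)
    (fun c x => by
      refine Real.sSup_le ?_ (mul_nonneg (norm_nonneg _) (Real.sSup_nonneg ?_))
      · rintro _ ⟨p, hp, rfl⟩
        exact (map_smul_eq_mul p.toSeminorm c x).le.trans
          (mul_le_mul_of_nonneg_left (le_csSup (hS x) ⟨p, hp, rfl⟩) (norm_nonneg _))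
      · rintro _ ⟨p, -, rfl⟩; exact apply_nonneg p.toSeminorm _)
  mul_le' x y := by
    have h0 (z : 𝒜) : 0 ≤ sSup ((fun p : CStarSeminorm 𝒜 => p z) '' S) := by
      refine Real.sSup_nonneg ?_
      rintro _ ⟨p, -, rfl⟩; exact apply_nonneg p.toSeminorm _
    refine Real.sSup_le ?_ (mul_nonneg (h0 x) (h0 y))
    rintro _ ⟨p, hp, rfl⟩
    exact (p.mul_le' x y).trans (mul_le_mul (le_csSup (hS x) ⟨p, hp, rfl⟩)
      (le_csSup (hS y) ⟨p, hp, rfl⟩) (apply_nonneg p.toSeminorm _) (h0 x))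
  sq_le' x := by
    have h0 (z : 𝒜) : 0 ≤ sSup ((fun p : CStarSeminorm 𝒜 => p z) '' S) := by
      refine Real.sSup_nonneg ?_
      rintro _ ⟨p, -, rfl⟩; exact apply_nonneg p.toSeminorm _
    change sSup _ * sSup _ ≤ sSup _
    have hb (y : ℝ) (hy : y ∈ (fun p : CStarSeminorm 𝒜 => p x) '' S) :
        y ≤ √(sSup ((fun p : CStarSeminorm 𝒜 => p (star x * x)) '' S)) := by
      obtain ⟨p, hp, rfl⟩ := hy
      exact Real.le_sqrt_of_sq_le ((sq _).le.trans
        ((p.sq_le' x).trans (le_csSup (hS (star x * x)) ⟨p, hp, rfl⟩)))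
    have := Real.sSup_le hb (Real.sqrt_nonneg _)
    calc _ ≤ _ := mul_le_mul this this (h0 x) (Real.sqrt_nonneg _)
      _ = _ := Real.mul_self_sqrt (h0 _)

end Sup

end CStarSeminorm

/-! ### The free *-algebra and universal C*-algebras -/

/-- The involution on words in the letters `g` (coded `(g, false)`) and `g*` (coded `(g, true)`). -/
def starWord {G : Type} (m : FreeMonoid (G × Bool)) : FreeMonoid (G × Bool) :=
  FreeMonoid.ofList ((FreeMonoid.toList m).reverse.map fun a => (a.1, !a.2))

theorem starWord_starWord {G : Type} (m : FreeMonoid (G × Bool)) : starWord (starWord m) = m := by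
  simp [starWord, List.map_reverse, Function.comp_def]

theorem starWord_mul {G : Type} (m m' : FreeMonoid (G × Bool)) :
    starWord (m * m') = starWord m' * starWord m := by
  simp [starWord]

/-- The free unital complex *-algebra on a set `G` of generators. -/
def FreeStar (G : Type) : Type := MonoidAlgebra ℂ (FreeMonoid (G × Bool))

namespace FreeStar

variable {G : Type}

instance : Ring (FreeStar G) := inferInstanceAs (Ring (MonoidAlgebra ℂ (FreeMonoid (G × Bool))))
instance : Algebra ℂ (FreeStar G) :=
  inferInstanceAs (Algebra ℂ (MonoidAlgebra ℂ (FreeMonoid (G × Bool))))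

/-- The multiple `c • m` of a word `m`. -/
def monom (m : FreeMonoid (G × Bool)) (c : ℂ) : FreeStar G := MonoidAlgebra.single m c

theorem induct {P : FreeStar G → Prop} (h0 : P 0) (hadd : ∀ x y, P x → P y → P (x + y))
    (hm : ∀ m c, P (monom m c)) (x : FreeStar G) : P x :=
  MonoidAlgebra.induction_linear (motive := P) x h0 hadd hm

theorem monom_mul (m m' : FreeMonoid (G × Bool)) (c c' : ℂ) :
    monom m c * monom m' c' = monom (m * m') (c * c') :=
  MonoidAlgebra.single_mul_single m m' c c'

/-- The conjugate-linear involution, as an additive map. -/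
def starHom : FreeStar G →+ FreeStar G where
  toFun x := (MonoidAlgebra.coeff x).sum fun m c => monom (starWord m) (star c)
  map_zero' := Finsupp.sum_zero_index
  map_add' x y := Finsupp.sum_add_index' (f := MonoidAlgebra.coeff x) (g := MonoidAlgebra.coeff y)
    (fun m => by rw [star_zero]; exact MonoidAlgebra.single_zero _)
    (fun m c c' => by rw [star_add]; exact MonoidAlgebra.single_add _ _ _)

theorem starHom_monom (m : FreeMonoid (G × Bool)) (c : ℂ) :
    starHom (monom m c) = monom (starWord m) (star c) :=
  Finsupp.sum_single_index (h := fun m c => monom (starWord m) (star c))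
    (by rw [star_zero]; exact MonoidAlgebra.single_zero _)

instance : StarRing (FreeStar G) where
  star := starHom
  star_involutive x := by
    induction x using induct with
    | h0 => simp
    | hadd x y hx hy => rw [map_add, map_add, hx, hy]
    | hm m c => rw [starHom_monom, starHom_monom, starWord_starWord, star_star]
  star_add := map_add _
  star_mul x y := by
    change starHom (x * y) = starHom y * starHom x
    induction x using induct with
    | h0 => simp
    | hadd x x' hx hx' => rw [map_add, add_mul, mul_add, map_add, hx, hx']
    | hm m c =>
      induction y using induct with
      | h0 => simp
      | hadd y y' hy hy' => rw [map_add, add_mul, mul_add, map_add, hy, hy']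
      | hm m' c' =>
        rw [monom_mul, starHom_monom, starHom_monom, starHom_monom, monom_mul, starWord_mul,
          star_mul]

theorem star_monom (m : FreeMonoid (G × Bool)) (c : ℂ) :
    star (monom m c) = monom (starWord m) (star c) :=
  starHom_monom m c

theorem smul_monom (a : ℂ) (m : FreeMonoid (G × Bool)) (c : ℂ) :
    a • monom m c = monom m (a * c) :=
  MonoidAlgebra.smul_single a m c

instance : StarModule ℂ (FreeStar G) where
  star_smul a x := by
    induction x using induct with
    | h0 => simp
    | hadd x y hx hy => rw [smul_add, star_add, star_add, smul_add, hx, hy]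
    | hm m c => rw [smul_monom, star_monom, star_monom, smul_monom, star_mul, mul_comm]

/-- The generator `g`. -/
def gen (g : G) : FreeStar G := monom (FreeMonoid.of (g, false)) 1

theorem monom_one (c : ℂ) : monom (1 : FreeMonoid (G × Bool)) c = algebraMap ℂ (FreeStar G) c := by
  rw [Algebra.algebraMap_eq_smul_one]
  exact (smul_monom c 1 1).symm ▸ by rw [mul_one]

theorem monom_cons (a : G × Bool) (m : FreeMonoid (G × Bool)) (c : ℂ) :
    monom (FreeMonoid.of a * m) c = (if a.2 then star (gen a.1) else gen a.1) * monom m c := by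
  obtain ⟨g, b⟩ := a
  cases b
  · simp [gen, monom_mul]
  · simp [gen, star_monom, starWord, monom_mul]

section Eval

variable {D : Type} [Ring D] [StarRing D] [Algebra ℂ D] (f : G → D)

/-- The evaluation of *-polynomials, as an algebra homomorphism. -/
def evalAlg : FreeStar G →ₐ[ℂ] D :=
  MonoidAlgebra.lift ℂ D (FreeMonoid (G × Bool))
    (FreeMonoid.lift fun a => if a.2 then star (f a.1) else f a.1)

theorem evalAlg_gen (g : G) : evalAlg f (gen g) = f g := by
  refine (MonoidAlgebra.lift_single _ _ _).trans ?_
  simp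

theorem evalAlg_star_gen (g : G) : evalAlg f (star (gen g)) = star (f g) := by
  rw [gen, star_monom]
  refine (MonoidAlgebra.lift_single _ _ _).trans ?_
  simp [starWord]

/-- The evaluation of *-polynomials at a family of elements of a *-algebra. -/
def eval [StarModule ℂ D] : FreeStar G →⋆ₐ[ℂ] D where
  __ := evalAlg f
  map_star' x := by
    change evalAlg f (star x) = star (evalAlg f x)
    induction x using induct with
    | h0 => simp
    | hadd x y hx hy => rw [star_add, map_add, map_add, star_add, hx, hy]
    | hm m c =>
      induction m using FreeMonoid.recOn with
      | one => rw [monom_one, ← algebraMap_star_comm, AlgHom.commutes, AlgHom.commutes,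
                algebraMap_star_comm]
      | of_mul a m hm =>
        rw [monom_cons, star_mul, map_mul, map_mul, star_mul, hm]
        congr 1
        obtain ⟨g, b⟩ := a
        cases b
        · simp [evalAlg_gen, evalAlg_star_gen]
        · simp [evalAlg_gen, evalAlg_star_gen]

theorem eval_gen [StarModule ℂ D] (g : G) : eval f (gen g) = f g := evalAlg_gen f g

end Eval

end FreeStar

/-- Generators and relations for a unital C*-algebra; each relation is a *-polynomial that is to
vanish, and the relations bound the C*-seminorms of the generators. -/
structure CStarPresentation (G : Type) where
  rels : Set (FreeStar G)
  bounded : ∀ g, ∃ C : ℝ, ∀ p : CStarSeminorm (FreeStar G), (∀ r ∈ rels, p r = 0) →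
    p (FreeStar.gen g) ≤ C

namespace CStarPresentation

variable {G : Type} (R : CStarPresentation G)

theorem exists_bound (x : FreeStar G) : ∃ C : ℝ, ∀ p : CStarSeminorm (FreeStar G),
    (∀ r ∈ R.rels, p r = 0) → p x ≤ C := by
  have hmul (x y : FreeStar G)
      (hx : ∃ C : ℝ, ∀ p : CStarSeminorm (FreeStar G), (∀ r ∈ R.rels, p r = 0) → p x ≤ C)
      (hy : ∃ C : ℝ, ∀ p : CStarSeminorm (FreeStar G), (∀ r ∈ R.rels, p r = 0) → p y ≤ C) :
      ∃ C : ℝ, ∀ p : CStarSeminorm (FreeStar G), (∀ r ∈ R.rels, p r = 0) → p (x * y) ≤ C := by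
    obtain ⟨C, hC⟩ := hx
    obtain ⟨C', hC'⟩ := hy
    exact ⟨C * C', fun p hp => (p.mul_le' x y).trans (mul_le_mul (hC p hp) (hC' p hp)
      (apply_nonneg p.toSeminorm _) ((apply_nonneg p.toSeminorm x).trans (hC p hp)))⟩
  induction x using FreeStar.induct with
  | h0 => exact ⟨0, fun p _ => (map_zero p.toSeminorm).le⟩
  | hadd x y hx hy =>
    obtain ⟨C, hC⟩ := hx
    obtain ⟨C', hC'⟩ := hy
    exact ⟨C + C', fun p hp => (map_add_le_add p.toSeminorm x y).trans
      (add_le_add (hC p hp) (hC' p hp))⟩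
  | hm m c =>
    induction m using FreeMonoid.recOn with
    | one =>
      refine ⟨‖c‖, fun p _ => ?_⟩
      have h1 : p (1 : FreeStar G) ≤ 1 := by
        have h := p.sq_le' 1
        rw [star_one, one_mul] at h
        change p 1 * p 1 ≤ p 1 at h
        have h0 : 0 ≤ p 1 := apply_nonneg p.toSeminorm _
        nlinarith
      rw [FreeStar.monom_one, Algebra.algebraMap_eq_smul_one]
      exact (map_smul_eq_mul p.toSeminorm c 1).le.trans
        (mul_le_of_le_one_right (norm_nonneg _) h1)
    | of_mul a m hm =>
      rw [FreeStar.monom_cons]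
      refine hmul _ _ ?_ hm
      obtain ⟨C, hC⟩ := R.bounded a.1
      refine ⟨C, fun p hp => ?_⟩
      split_ifs
      · exact (p.map_star _).le.trans (hC p hp)
      · exact hC p hp

/-- The largest C*-seminorm on the *-algebra with the given generators and relations, pulled back to
the free *-algebra. -/
def maxSeminorm : CStarSeminorm (FreeStar G) :=
  CStarSeminorm.sSupOf {p | ∀ r ∈ R.rels, p r = 0} fun x => by
    obtain ⟨C, hC⟩ := R.exists_bound x
    refine ⟨C, ?_⟩
    rintro _ ⟨p, hp, rfl⟩
    exact hC p hp

/-- The universal unital C*-algebra with the given generators and relations. -/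
def Alg : Type := R.maxSeminorm.Completion

instance : CStarAlgebra R.Alg := inferInstanceAs (CStarAlgebra R.maxSeminorm.Completion)

/-- The canonical *-homomorphism of the free *-algebra to the universal C*-algebra. -/
def toAlg : FreeStar G →⋆ₐ[ℂ] R.Alg := R.maxSeminorm.toCompletion

theorem norm_toAlg (x : FreeStar G) : ‖R.toAlg x‖ = R.maxSeminorm x :=
  R.maxSeminorm.norm_toCompletion x

/-- The generator `g` of the universal C*-algebra. -/
def gen (g : G) : R.Alg := R.toAlg (FreeStar.gen g)

theorem toAlg_rel {r : FreeStar G} (hr : r ∈ R.rels) : R.toAlg r = 0 := by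
  rw [← norm_eq_zero, norm_toAlg]
  refine le_antisymm (Real.sSup_le ?_ le_rfl) (apply_nonneg R.maxSeminorm.toSeminorm _)
  rintro _ ⟨p, hp, rfl⟩
  exact (hp r hr).le

/-- The universal property. -/
def lift {D : Type} [CStarAlgebra D] (f : G → D) (h : ∀ r ∈ R.rels, FreeStar.eval f r = 0) :
    R.Alg →⋆ₐ[ℂ] D :=
  CStarSeminorm.lift (p := R.maxSeminorm) (FreeStar.eval f) fun x => by
    obtain ⟨C, hC⟩ := R.exists_bound x
    refine le_csSup ⟨C, ?_⟩ ⟨CStarSeminorm.ofHom (FreeStar.eval f), fun r hr => ?_, rfl⟩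
    · rintro _ ⟨p, hp, rfl⟩
      exact hC p hp
    · exact (congrArg norm (h r hr)).trans norm_zero

theorem lift_gen {D : Type} [CStarAlgebra D] (f : G → D)
    (h : ∀ r ∈ R.rels, FreeStar.eval f r = 0) (g : G) : R.lift f h (R.gen g) = f g :=
  (CStarSeminorm.lift_toCompletion _ _ _).trans (FreeStar.eval_gen f g)

end CStarPresentation


/-! ### The minimal tensor product -/

namespace MinTensor

section Spatial

variable {A B H K : Type} [CStarAlgebra A] [CStarAlgebra B]
  [NormedAddCommGroup H] [InnerProductSpace ℂ H] [CompleteSpace H]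
  [NormedAddCommGroup K] [InnerProductSpace ℂ K] [CompleteSpace K]

/-- For representations `π` of `A` on `H` and `σ` of `B` on `K`, the representation of the algebraic
tensor product of `A` and `B` on the (algebraic) tensor product of the Hilbert spaces, sending
`a ⊗ b` to `π a ⊗ σ b`. -/
def spatialRep (π : A →⋆ₐ[ℂ] (H →L[ℂ] H)) (σ : B →⋆ₐ[ℂ] (K →L[ℂ] K)) :
    (A ⊗[ℂ] B) →ₐ[ℂ] ((H ⊗[ℂ] K) →L[ℂ] (H ⊗[ℂ] K)) :=
  Algebra.TensorProduct.lift
    (AlgHom.ofLinearMap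
      { toFun := fun a => (π a).rTensor K
        map_add' := fun a b => by rw [map_add, ContinuousLinearMap.rTensor_add]
        map_smul' := fun c a => by rw [map_smul, ContinuousLinearMap.rTensor_smul]; rfl }
      ((congrArg _ (map_one π)).trans (ContinuousLinearMap.rTensor_one K))
      (fun a b => (congrArg _ (map_mul π a b)).trans (ContinuousLinearMap.rTensor_mul K _ _)))
    (AlgHom.ofLinearMap
      { toFun := fun b => (σ b).lTensor H
        map_add' := fun a b => by rw [map_add, ContinuousLinearMap.lTensor_add]
        map_smul' := fun c a => by rw [map_smul, ContinuousLinearMap.lTensor_smul]; rfl }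
      ((congrArg _ (map_one σ)).trans (ContinuousLinearMap.lTensor_one H))
      (fun a b => (congrArg _ (map_mul σ a b)).trans (ContinuousLinearMap.lTensor_mul H _ _)))
    (fun a b => by
      ext x
      induction x using TensorProduct.induction_on with
      | zero => simp
      | tmul x y => simp
      | add x y hx hy => rw [map_add, map_add, hx, hy])

theorem spatialRep_tmul (π : A →⋆ₐ[ℂ] (H →L[ℂ] H)) (σ : B →⋆ₐ[ℂ] (K →L[ℂ] K)) (a : A) (b : B) :
    spatialRep π σ (a ⊗ₜ b) = TensorProduct.mapL (π a) (σ b) :=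
  Algebra.TensorProduct.lift_tmul _ _ _ _ _

theorem inner_spatialRep (π : A →⋆ₐ[ℂ] (H →L[ℂ] H)) (σ : B →⋆ₐ[ℂ] (K →L[ℂ] K)) (x : A ⊗[ℂ] B)
    (v w : H ⊗[ℂ] K) :
    inner ℂ (spatialRep π σ x v) w = inner ℂ v (spatialRep π σ (star x) w) := by
  induction x using TensorProduct.induction_on with
  | zero => simp
  | add x y hx hy =>
    rw [star_add, map_add, map_add, add_apply, add_apply,
      inner_add_left, inner_add_right, hx, hy]
  | tmul a b =>
    rw [TensorProduct.star_tmul, spatialRep_tmul, spatialRep_tmul, StarHomClass.map_star,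
      StarHomClass.map_star, ContinuousLinearMap.star_eq_adjoint,
      ContinuousLinearMap.star_eq_adjoint]
    induction v using TensorProduct.induction_on with
    | zero => simp
    | add v v' hv hv' => rw [map_add, inner_add_left, inner_add_left, hv, hv']
    | tmul h k =>
      induction w using TensorProduct.induction_on with
      | zero => simp
      | add w w' hw hw' => rw [map_add, inner_add_right, inner_add_right, hw, hw']
      | tmul h' k' =>
        simp [ContinuousLinearMap.adjoint_inner_right]

/-- The C*-seminorm `x ↦ ‖(π ⊗ σ)(x)‖` on the algebraic tensor product. -/
def spatialSeminorm (π : A →⋆ₐ[ℂ] (H →L[ℂ] H)) (σ : B →⋆ₐ[ℂ] (K →L[ℂ] K)) :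
    CStarSeminorm (A ⊗[ℂ] B) where
  toSeminorm := Seminorm.ofSMulLE (fun x => ‖spatialRep π σ x‖)
    ((congrArg norm (map_zero (spatialRep π σ))).trans ContinuousLinearMap.opNorm_zero)
    (fun x y => (congrArg norm (map_add (spatialRep π σ) x y)).le.trans
      (ContinuousLinearMap.opNorm_add_le _ _))
    (fun c x => (congrArg norm (map_smul (spatialRep π σ) c x)).le.trans
      (ContinuousLinearMap.opNorm_smul_le _ _))
  mul_le' x y := (congrArg norm (map_mul (spatialRep π σ) x y)).le.trans
    (ContinuousLinearMap.opNorm_comp_le _ _)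
  sq_le' x := by
    change ‖spatialRep π σ x‖ * ‖spatialRep π σ x‖ ≤ ‖spatialRep π σ (star x * x)‖
    have h : ‖spatialRep π σ x‖ ≤ √‖spatialRep π σ (star x * x)‖ := by
      refine ContinuousLinearMap.opNorm_le_bound _ (Real.sqrt_nonneg _) fun v => ?_
      refine (sq_le_sq₀ (norm_nonneg _) (by positivity)).1 ?_
      rw [mul_pow, Real.sq_sqrt (ContinuousLinearMap.opNorm_nonneg _), ← inner_self_eq_norm_sq (𝕜 := ℂ),
        inner_spatialRep, ← mul_apply_eq_comp, ← map_mul]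
      refine (re_inner_le_norm (𝕜 := ℂ) v _).trans ?_
      have := (spatialRep π σ (star x * x)).le_opNorm v
      nlinarith [norm_nonneg v]
    calc _ ≤ _ := mul_le_mul h h (ContinuousLinearMap.opNorm_nonneg _) (Real.sqrt_nonneg _)
      _ = _ := Real.mul_self_sqrt (ContinuousLinearMap.opNorm_nonneg _)

end Spatial

/-- The seminorms `x ↦ ‖(π ⊗ σ)(x)‖`, for all pairs of representations on Hilbert spaces. -/
def spatialSeminorms (A B : Type) [CStarAlgebra A] [CStarAlgebra B] :
    Set (CStarSeminorm (A ⊗[ℂ] B)) :=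
  {p | ∃ (H K : Type) (_ : NormedAddCommGroup H) (_ : InnerProductSpace ℂ H) (_ : CompleteSpace H)
    (_ : NormedAddCommGroup K) (_ : InnerProductSpace ℂ K) (_ : CompleteSpace K)
    (π : A →⋆ₐ[ℂ] (H →L[ℂ] H)) (σ : B →⋆ₐ[ℂ] (K →L[ℂ] K)), p = spatialSeminorm π σ}

theorem bddAbove_spatialSeminorms {A B : Type} [CStarAlgebra A] [CStarAlgebra B] (x : A ⊗[ℂ] B) :
    BddAbove ((fun p : CStarSeminorm (A ⊗[ℂ] B) => p x) '' spatialSeminorms A B) := by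
  induction x using TensorProduct.induction_on with
  | zero =>
    refine ⟨0, ?_⟩
    rintro _ ⟨p, -, rfl⟩
    exact (map_zero p.toSeminorm).le
  | tmul a b =>
    refine ⟨‖a‖ * ‖b‖, ?_⟩
    rintro _ ⟨_, ⟨H, K, _, _, _, _, _, _, π, σ, rfl⟩, rfl⟩
    change ‖spatialRep π σ (a ⊗ₜ b)‖ ≤ _
    rw [spatialRep_tmul]
    exact (TensorProduct.norm_mapL_le _ _).trans (mul_le_mul (NonUnitalStarAlgHom.norm_apply_le π a)
      (NonUnitalStarAlgHom.norm_apply_le σ b) (norm_nonneg _) (norm_nonneg _))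
  | add x y hx hy =>
    obtain ⟨C, hC⟩ := hx
    obtain ⟨C', hC'⟩ := hy
    refine ⟨C + C', ?_⟩
    rintro _ ⟨p, hp, rfl⟩
    exact (map_add_le_add p.toSeminorm x y).trans
      (add_le_add (hC ⟨p, hp, rfl⟩) (hC' ⟨p, hp, rfl⟩))

/-- The minimal (spatial) C*-norm on the algebraic tensor product. -/
def minSeminorm (A B : Type) [CStarAlgebra A] [CStarAlgebra B] : CStarSeminorm (A ⊗[ℂ] B) :=
  CStarSeminorm.sSupOf (spatialSeminorms A B) bddAbove_spatialSeminorms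

end MinTensor

/-- The minimal tensor product of two unital C*-algebras. -/
def MinTensor (A B : Type) [CStarAlgebra A] [CStarAlgebra B] : Type :=
  (MinTensor.minSeminorm A B).Completion

instance (A B : Type) [CStarAlgebra A] [CStarAlgebra B] : CStarAlgebra (MinTensor A B) :=
  inferInstanceAs (CStarAlgebra (MinTensor.minSeminorm A B).Completion)

namespace MinTensor

variable {A B A' B' : Type} [CStarAlgebra A] [CStarAlgebra B] [CStarAlgebra A'] [CStarAlgebra B']

/-- The canonical *-homomorphism of the algebraic tensor product. -/
def ofAlg (A B : Type) [CStarAlgebra A] [CStarAlgebra B] : (A ⊗[ℂ] B) →⋆ₐ[ℂ] MinTensor A B :=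
  (minSeminorm A B).toCompletion

theorem norm_ofAlg (x : A ⊗[ℂ] B) : ‖ofAlg A B x‖ = minSeminorm A B x :=
  (minSeminorm A B).norm_toCompletion x

/-- The elementary tensor `a ⊗ b`. -/
def tmul (a : A) (b : B) : MinTensor A B := ofAlg A B (a ⊗ₜ b)

theorem tmul_mul (a a' : A) (b b' : B) : tmul a b * tmul a' b' = tmul (a * a') (b * b') := by
  rw [tmul, tmul, ← map_mul, Algebra.TensorProduct.tmul_mul_tmul]; rfl

theorem star_tmul (a : A) (b : B) : star (tmul a b) = tmul (star a) (star b) := by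
  rw [tmul, ← StarHomClass.map_star, TensorProduct.star_tmul]; rfl

theorem one_tmul_one : tmul (1 : A) (1 : B) = 1 :=
  map_one (ofAlg A B)

theorem zero_tmul (b : B) : tmul (0 : A) b = 0 := by
  rw [tmul, TensorProduct.zero_tmul, map_zero]

theorem sum_tmul {ι : Type} (s : Finset ι) (a : ι → A) (b : B) :
    tmul (∑ i ∈ s, a i) b = ∑ i ∈ s, tmul (a i) b := by
  rw [tmul, TensorProduct.sum_tmul, map_sum]; rfl

theorem smul_tmul (c : ℂ) (a : A) (b : B) : tmul (c • a) b = c • tmul a b := by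
  rw [tmul, ← TensorProduct.smul_tmul', map_smul]; rfl

/-- `a ↦ a ⊗ 1`. -/
def inl (A B : Type) [CStarAlgebra A] [CStarAlgebra B] : A →⋆ₐ[ℂ] MinTensor A B where
  __ := (ofAlg A B).toAlgHom.comp Algebra.TensorProduct.includeLeft
  map_star' a := by
    change tmul (star a) 1 = star (tmul a 1)
    rw [star_tmul, star_one]

/-- `b ↦ 1 ⊗ b`. -/
def inr (A B : Type) [CStarAlgebra A] [CStarAlgebra B] : B →⋆ₐ[ℂ] MinTensor A B where
  __ := (ofAlg A B).toAlgHom.comp Algebra.TensorProduct.includeRight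
  map_star' a := by
    change tmul 1 (star a) = star (tmul 1 a)
    rw [star_tmul, star_one]

theorem inl_apply (a : A) : inl A B a = tmul a 1 := rfl

theorem inr_apply (b : B) : inr A B b = tmul 1 b := rfl

/-- `a ⊗ b ↦ f a ⊗ g b` on the algebraic tensor product. -/
def mapAlg (f : A →⋆ₐ[ℂ] A') (g : B →⋆ₐ[ℂ] B') : (A ⊗[ℂ] B) →⋆ₐ[ℂ] (A' ⊗[ℂ] B') where
  __ := Algebra.TensorProduct.map f.toAlgHom g.toAlgHom
  map_star' x := by
    change Algebra.TensorProduct.map f.toAlgHom g.toAlgHom (star x) =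
      star (Algebra.TensorProduct.map f.toAlgHom g.toAlgHom x)
    induction x using TensorProduct.induction_on with
    | zero => simp
    | tmul a b =>
      change f (star a) ⊗ₜ g (star b) = star (f a) ⊗ₜ[ℂ] star (g b)
      rw [StarHomClass.map_star, StarHomClass.map_star]
    | add x y hx hy => rw [star_add, map_add, map_add, star_add, hx, hy]

theorem spatialRep_mapAlg {H K : Type}
    [NormedAddCommGroup H] [InnerProductSpace ℂ H] [CompleteSpace H]
    [NormedAddCommGroup K] [InnerProductSpace ℂ K] [CompleteSpace K]
    (f : A →⋆ₐ[ℂ] A') (g : B →⋆ₐ[ℂ] B')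
    (π : A' →⋆ₐ[ℂ] (H →L[ℂ] H)) (σ : B' →⋆ₐ[ℂ] (K →L[ℂ] K)) (x : A ⊗[ℂ] B) :
    spatialRep π σ (mapAlg f g x) = spatialRep (π.comp f) (σ.comp g) x := by
  induction x using TensorProduct.induction_on with
  | zero => simp
  | tmul a b => rw [spatialRep_tmul]; exact spatialRep_tmul π σ (f a) (g b)
  | add x y hx hy => rw [map_add, map_add, map_add, hx, hy]

/-- The *-homomorphism `f ⊗ g` of minimal tensor products. -/
def map (f : A →⋆ₐ[ℂ] A') (g : B →⋆ₐ[ℂ] B') : MinTensor A B →⋆ₐ[ℂ] MinTensor A' B' :=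
  CStarSeminorm.lift (p := minSeminorm A B) ((ofAlg A' B').comp (mapAlg f g)) fun x => by
    rw [StarAlgHom.comp_apply, norm_ofAlg]
    refine Real.sSup_le ?_ (apply_nonneg (minSeminorm A B).toSeminorm _)
    rintro _ ⟨_, ⟨H, K, _, _, _, _, _, _, π, σ, rfl⟩, rfl⟩
    refine le_csSup (bddAbove_spatialSeminorms x)
      ⟨spatialSeminorm (π.comp f) (σ.comp g), ⟨H, K, _, _, _, _, _, _, _, _, rfl⟩, ?_⟩
    exact (congrArg norm (spatialRep_mapAlg f g π σ x)).symm

theorem map_tmul (f : A →⋆ₐ[ℂ] A') (g : B →⋆ₐ[ℂ] B') (a : A) (b : B) :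
    map f g (tmul a b) = tmul (f a) (g b) :=
  CStarSeminorm.lift_toCompletion _ _ _

end MinTensor

/-! ### The circle -/

/-- The C*-algebra of continuous functions on the circle. -/
abbrev CircleAlg : Type := C(Circle, ℂ)

namespace CircleAlg

/-- The function `z ↦ z ^ k` on the circle. -/
def zpow (k : ℤ) : CircleAlg := ⟨fun w => ((w ^ k : Circle) : ℂ), continuous_induced_dom.comp (continuous_zpow k)⟩

/-- The identity function. -/
def z : CircleAlg := zpow 1

theorem mem_circle {D : Type} [CStarAlgebra D] {w : D} (hw : w ∈ unitary D) (x : spectrum ℂ w) :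
    (x : ℂ) ∈ Submonoid.unitSphere ℂ :=
  spectrum.subset_circle_of_unitary hw x.2

/-- The unital *-homomorphism with `z ↦ w`, for a unitary element `w` of a C*-algebra. -/
def lift {D : Type} [CStarAlgebra D] (w : D) (hw : w ∈ unitary D) : CircleAlg →⋆ₐ[ℂ] D :=
  have : IsStarNormal w := ⟨by rw [Commute, SemiconjBy, hw.1, hw.2]⟩
  (cfcHom (R := ℂ) (a := w) this).comp
    (ContinuousMap.compStarAlgHom' ℂ ℂ
      (⟨fun x => (⟨x, mem_circle hw x⟩ : Circle), by fun_prop⟩ : C(spectrum ℂ w, Circle)))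

theorem lift_z {D : Type} [CStarAlgebra D] (w : D) (hw : w ∈ unitary D) : lift w hw z = w := by
  have : IsStarNormal w := ⟨by rw [Commute, SemiconjBy, hw.1, hw.2]⟩
  refine Eq.trans ?_ (cfcHom_id (R := ℂ) (a := w) this)
  refine congrArg (cfcHom (R := ℂ) (a := w) this) ?_
  ext x
  simp [z, zpow]
  rfl

theorem star_zpow_mul (k l : ℤ) : star (zpow k) * zpow l = zpow (l - k) := by
  ext w
  simp [zpow, zpow_sub, mul_comm, ← Circle.coe_inv_eq_conj]

theorem zpow_mul (k l : ℤ) : zpow k * zpow l = zpow (k + l) := by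
  ext w
  simp [zpow, zpow_add]

theorem star_zpow (k : ℤ) : star (zpow k) = zpow (-k) := by
  ext w
  simp [zpow, ← Circle.coe_inv_eq_conj]

theorem zpow_zero : zpow 0 = 1 := by
  ext w
  simp [zpow]

end CircleAlg

/-! ### The noncommutative torus -/

/-- A family `v` with `∑ i, v i* v i = 1` in a C*-algebra consists of contractions. -/
theorem norm_le_one_of_sum_star_mul_self {D ι : Type} [CStarAlgebra D] [Fintype ι] (v : ι → D)
    (h : ∑ i, star (v i) * v i = 1) (i : ι) : ‖v i‖ ≤ 1 := by
  let _ : PartialOrder D := CStarAlgebra.spectralOrder D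
  have _ : StarOrderedRing D := CStarAlgebra.spectralOrderedRing D
  have h1 : star (v i) * v i ≤ 1 := h ▸ Finset.single_le_sum
    (f := fun i => star (v i) * v i) (fun j _ => star_mul_self_nonneg (v j)) (Finset.mem_univ i)
  have h2 := CStarAlgebra.norm_le_norm_of_nonneg_of_le (star_mul_self_nonneg (v i)) h1
  rw [CStarRing.norm_star_mul_self] at h2
  have h3 : ‖(1 : D)‖ ≤ 1 := by
    rcases subsingleton_or_nontrivial D with hD | hD
    · rw [Subsingleton.elim (1 : D) 0, norm_zero]; exact zero_le_one
    · exact CStarRing.norm_one.le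
  nlinarith [norm_nonneg (v i)]

theorem CStarSeminorm.le_one_of_sum {𝒜 ι : Type} [Ring 𝒜] [StarRing 𝒜] [Algebra ℂ 𝒜]
    [StarModule ℂ 𝒜] [Fintype ι] (p : CStarSeminorm 𝒜) (v : ι → 𝒜)
    (h : p (∑ i, star (v i) * v i - 1) = 0) (i : ι) : p (v i) ≤ 1 := by
  rw [← p.norm_toCompletion, norm_eq_zero, map_sub, map_sum, map_one, sub_eq_zero] at h
  rw [← p.norm_toCompletion]
  exact norm_le_one_of_sum_star_mul_self (fun i => p.toCompletion (v i)) (h ▸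
    Finset.sum_congr rfl fun k _ => by rw [map_mul, StarHomClass.map_star]) i

/-- Generators `U = gen false`, `V = gen true`: unitaries with `V U = ζ U V`. -/
def torusPresentation (ζ : Circle) : CStarPresentation Bool where
  rels := {r | ∃ g, r = star (FreeStar.gen g) * FreeStar.gen g - 1 ∨
      r = FreeStar.gen g * star (FreeStar.gen g) - 1} ∪
    {FreeStar.gen true * FreeStar.gen false -
      (ζ : ℂ) • (FreeStar.gen false * FreeStar.gen true)}
  bounded g := ⟨1, fun p hp => p.le_one_of_sum (fun _ : Unit => FreeStar.gen g)
    (hp _ (Or.inl ⟨g, Or.inl (by simp)⟩)) ()⟩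

/-- The C*-algebra of the noncommutative torus: the universal unital C*-algebra generated by two
unitaries `U`, `V` with `V U = ζ U V`. -/
abbrev TorusAlg (ζ : Circle) : Type := (torusPresentation ζ).Alg

namespace TorusAlg

variable (ζ : Circle)

/-- The first generator. -/
def U : TorusAlg ζ := (torusPresentation ζ).gen false

/-- The second generator. -/
def V : TorusAlg ζ := (torusPresentation ζ).gen true

theorem gen_mem_unitary (g : Bool) : (torusPresentation ζ).gen g ∈ unitary (TorusAlg ζ) := by
  refine ⟨?_, ?_⟩
  · have := (torusPresentation ζ).toAlg_rel (Or.inl ⟨g, Or.inl rfl⟩)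
    rwa [map_sub, map_mul, StarHomClass.map_star, map_one, sub_eq_zero] at this
  · have := (torusPresentation ζ).toAlg_rel (Or.inl ⟨g, Or.inr rfl⟩)
    rwa [map_sub, map_mul, StarHomClass.map_star, map_one, sub_eq_zero] at this

/-- The *-homomorphism `z ↦ U`. -/
def ι₁ : CircleAlg →⋆ₐ[ℂ] TorusAlg ζ := CircleAlg.lift (U ζ) (gen_mem_unitary ζ false)

/-- The *-homomorphism `z ↦ V`. -/
def ι₂ : CircleAlg →⋆ₐ[ℂ] TorusAlg ζ := CircleAlg.lift (V ζ) (gen_mem_unitary ζ true)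

end TorusAlg

/-! ### The braided tensor product -/

namespace Braided

variable (ζ : Circle) {X Y : Type} [CStarAlgebra X] [CStarAlgebra Y]

/-- The *-homomorphism `j₁`, with `j₁ x = x ⊗ 1 ⊗ U ^ k` for `x` homogeneous of degree `k`. -/
def j₁Amb (ρX : X →⋆ₐ[ℂ] MinTensor X CircleAlg) (Y : Type) [CStarAlgebra Y] :
    X →⋆ₐ[ℂ] MinTensor (MinTensor X Y) (TorusAlg ζ) :=
  (MinTensor.map (MinTensor.inl X Y) (TorusAlg.ι₁ ζ)).comp ρX

/-- The *-homomorphism `j₂`, with `j₂ y = 1 ⊗ y ⊗ V ^ l` for `y` homogeneous of degree `l`. -/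
def j₂Amb (X : Type) [CStarAlgebra X] (ρY : Y →⋆ₐ[ℂ] MinTensor Y CircleAlg) :
    Y →⋆ₐ[ℂ] MinTensor (MinTensor X Y) (TorusAlg ζ) :=
  (MinTensor.map (MinTensor.inr X Y) (TorusAlg.ι₂ ζ)).comp ρY

/-- The C*-subalgebra generated by the ranges of `j₁` and `j₂`. For coactions of the circle this is
the closed linear span of the products `j₁ x * j₂ y`, because
`j₂ y * j₁ x = ζ ^ (k * l) • (j₁ x * j₂ y)` for homogeneous `x`, `y` of degrees `k`, `l`. -/
def carrier (ρX : X →⋆ₐ[ℂ] MinTensor X CircleAlg) (ρY : Y →⋆ₐ[ℂ] MinTensor Y CircleAlg) :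
    StarSubalgebra ℂ (MinTensor (MinTensor X Y) (TorusAlg ζ)) :=
  (StarAlgebra.adjoin ℂ
    (Set.range (j₁Amb ζ ρX Y) ∪ Set.range (j₂Amb ζ X ρY))).topologicalClosure

instance (ρX : X →⋆ₐ[ℂ] MinTensor X CircleAlg) (ρY : Y →⋆ₐ[ℂ] MinTensor Y CircleAlg) :
    IsClosed (carrier ζ ρX ρY : Set (MinTensor (MinTensor X Y) (TorusAlg ζ))) :=
  StarSubalgebra.isClosed_topologicalClosure _

end Braided

/-- The braided tensor product `X ⊠_ζ Y` of two C*-algebras with coactions `ρX`, `ρY` of the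
circle. -/
def Braided (ζ : Circle) {X Y : Type} [CStarAlgebra X] [CStarAlgebra Y]
    (ρX : X →⋆ₐ[ℂ] MinTensor X CircleAlg) (ρY : Y →⋆ₐ[ℂ] MinTensor Y CircleAlg) : Type :=
  Braided.carrier ζ ρX ρY

instance (ζ : Circle) {X Y : Type} [CStarAlgebra X] [CStarAlgebra Y]
    (ρX : X →⋆ₐ[ℂ] MinTensor X CircleAlg) (ρY : Y →⋆ₐ[ℂ] MinTensor Y CircleAlg) :
    CStarAlgebra (Braided ζ ρX ρY) :=
  inferInstanceAs (CStarAlgebra (Braided.carrier ζ ρX ρY))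

namespace Braided

variable (ζ : Circle) {X Y : Type} [CStarAlgebra X] [CStarAlgebra Y]
  (ρX : X →⋆ₐ[ℂ] MinTensor X CircleAlg) (ρY : Y →⋆ₐ[ℂ] MinTensor Y CircleAlg)

/-- The inclusion of `X ⊠_ζ Y` in `X ⊗ Y ⊗ C(𝕋²_ζ)`. -/
def incl : Braided ζ ρX ρY →⋆ₐ[ℂ] MinTensor (MinTensor X Y) (TorusAlg ζ) :=
  (carrier ζ ρX ρY).subtype

/-- The canonical *-homomorphism `X → X ⊠_ζ Y`. -/
def j₁ : X →⋆ₐ[ℂ] Braided ζ ρX ρY :=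
  (j₁Amb ζ ρX Y).codRestrict _ fun x => StarSubalgebra.le_topologicalClosure _
    (StarAlgebra.subset_adjoin ℂ _ (Or.inl ⟨x, rfl⟩))

/-- The canonical *-homomorphism `Y → X ⊠_ζ Y`. -/
def j₂ : Y →⋆ₐ[ℂ] Braided ζ ρX ρY :=
  (j₂Amb ζ X ρY).codRestrict _ fun y => StarSubalgebra.le_topologicalClosure _
    (StarAlgebra.subset_adjoin ℂ _ (Or.inr ⟨y, rfl⟩))

end Braided

/-- The comultiplication `z ↦ z ⊗ z` of `C(𝕋)`, which is also the coaction of `C(𝕋)` on itself. -/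
def CircleAlg.comul : CircleAlg →⋆ₐ[ℂ] MinTensor CircleAlg CircleAlg :=
  CircleAlg.lift (MinTensor.tmul CircleAlg.z CircleAlg.z) (by
    refine ⟨?_, ?_⟩ <;>
    · rw [MinTensor.star_tmul, MinTensor.tmul_mul, CircleAlg.z, CircleAlg.star_zpow,
        CircleAlg.zpow_mul]
      norm_num [CircleAlg.zpow_zero, MinTensor.one_tmul_one])

/-! ### The braided free unitary quantum group -/

/-- An invertible matrix `F`, with `F⁻¹ = (F^{ij})`, and degrees `d`, `d'`, `e` such that
`F_{ij} = 0 = F^{ji}` whenever `e - d_j ≠ d'_i`. -/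
structure AdmissibleMatrix (n : ℕ) where
  F : GL (Fin n) ℂ
  d : Fin n → ℤ
  d' : Fin n → ℤ
  e : ℤ
  compat : ∀ i j, -d j + e ≠ d' i → F.1 i j = 0 ∧ F⁻¹.1 j i = 0

namespace AdmissibleMatrix

variable {n : ℕ} (P : AdmissibleMatrix n) (ζ : Circle)
  {D : Type} [Ring D] [StarRing D] [Algebra ℂ D]

/-- The braided conjugate `(ζ ^ (d_i (d_j - d_i)) u_{ij}*)` of a matrix. -/
def conj (u : Matrix (Fin n) (Fin n) D) : Matrix (Fin n) (Fin n) D :=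
  Matrix.of fun i j => ((ζ ^ (P.d i * (P.d j - P.d i)) : Circle) : ℂ) • star (u i j)

/-- The matrix `F ū_ζ F⁻¹`. -/
def twist (u : Matrix (Fin n) (Fin n) D) : Matrix (Fin n) (Fin n) D :=
  P.F.1.map (algebraMap ℂ D) * P.conj ζ u * P.F⁻¹.1.map (algebraMap ℂ D)

/-- The matrix of free generators. -/
def freeGen (n : ℕ) : Matrix (Fin n) (Fin n) (FreeStar (Fin n × Fin n)) :=
  Matrix.of fun i j => FreeStar.gen (i, j)

/-- Generators `u_{ij}`; the relations say that `u` and `F ū_ζ F⁻¹` are unitary. -/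
def presentation : CStarPresentation (Fin n × Fin n) where
  rels := {r | ∃ M ∈ ({freeGen n, P.twist ζ (freeGen n)} : Set _), ∃ i j,
    r = (star M * M - 1) i j ∨ r = (M * star M - 1) i j}
  bounded g := ⟨1, fun p hp => p.le_one_of_sum (fun k => FreeStar.gen (k, g.2))
    (hp _ ⟨freeGen n, Or.inl rfl, g.2, g.2, Or.inl (by
      simp [freeGen, Matrix.mul_apply, Matrix.sub_apply])⟩) g.1⟩

/-- The C*-algebra of the braided free unitary quantum group: the universal unital C*-algebra
generated by the entries of a matrix `u` such that `u` and `F ū_ζ F⁻¹` are unitary. -/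
abbrev FreeUnitaryAlg : Type := (P.presentation ζ).Alg

/-- The fundamental matrix. -/
def u : Matrix (Fin n) (Fin n) (P.FreeUnitaryAlg ζ) :=
  Matrix.of fun i j => (P.presentation ζ).gen (i, j)

end AdmissibleMatrix

namespace AdmissibleMatrix

section Maps

variable {n : ℕ} (P : AdmissibleMatrix n) (ζ : Circle) {D D' : Type} [Ring D] [StarRing D]
  [Algebra ℂ D] [Ring D'] [StarRing D'] [Algebra ℂ D']

theorem twist_apply (u : Matrix (Fin n) (Fin n) D) (i j : Fin n) :
    P.twist ζ u i j = ∑ b, ∑ a, (P.F.1 i a * ((ζ ^ (P.d a * (P.d b - P.d a)) : Circle) : ℂ) *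
      P.F⁻¹.1 b j) • star (u a b) := by
  simp only [twist, conj, Matrix.mul_apply, Matrix.map_apply, Matrix.of_apply, Finset.sum_mul]
  refine Finset.sum_congr rfl fun b _ => Finset.sum_congr rfl fun a _ => ?_
  rw [← Algebra.smul_def, ← Algebra.commutes, ← Algebra.smul_def, smul_smul, smul_smul]
  congr 1
  ring

theorem map_twist (φ : D →⋆ₐ[ℂ] D') (u : Matrix (Fin n) (Fin n) D) :
    (P.twist ζ u).map φ = P.twist ζ (u.map φ) := by
  ext i j
  simp [twist_apply, StarHomClass.map_star]

theorem map_star_mul_self (φ : D →⋆ₐ[ℂ] D') (u : Matrix (Fin n) (Fin n) D) (i j : Fin n) :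
    φ ((star u * u - 1) i j) = (star (u.map φ) * u.map φ - 1) i j := by
  simp [Matrix.mul_apply, Matrix.one_apply, StarHomClass.map_star, apply_ite φ]

theorem map_self_mul_star (φ : D →⋆ₐ[ℂ] D') (u : Matrix (Fin n) (Fin n) D) (i j : Fin n) :
    φ ((u * star u - 1) i j) = (u.map φ * star (u.map φ) - 1) i j := by
  simp [Matrix.mul_apply, Matrix.one_apply, StarHomClass.map_star, apply_ite φ]

end Maps

section Universal

variable {n : ℕ} (P : AdmissibleMatrix n) (ζ : Circle)

/-- The universal property of the C*-algebra of the braided free unitary quantum group. -/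
def lift {D : Type} [CStarAlgebra D] (w : Matrix (Fin n) (Fin n) D)
    (hw : w ∈ unitary (Matrix (Fin n) (Fin n) D))
    (hw' : P.twist ζ w ∈ unitary (Matrix (Fin n) (Fin n) D)) : P.FreeUnitaryAlg ζ →⋆ₐ[ℂ] D :=
  (P.presentation ζ).lift (fun g => w g.1 g.2) (by
    have hf : (freeGen n).map (FreeStar.eval fun g : Fin n × Fin n => w g.1 g.2) = w := by
      ext i j
      exact FreeStar.eval_gen (fun g : Fin n × Fin n => w g.1 g.2) (i, j)
    rintro r ⟨M, rfl | rfl, i, j, rfl | rfl⟩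
    · rw [map_star_mul_self, hf, hw.1, sub_self, Matrix.zero_apply]
    · rw [map_self_mul_star, hf, hw.2, sub_self, Matrix.zero_apply]
    · rw [map_star_mul_self, map_twist, hf, hw'.1, sub_self, Matrix.zero_apply]
    · rw [map_self_mul_star, map_twist, hf, hw'.2, sub_self, Matrix.zero_apply])

theorem lift_u {D : Type} [CStarAlgebra D] (w : Matrix (Fin n) (Fin n) D)
    (hw : w ∈ unitary (Matrix (Fin n) (Fin n) D))
    (hw' : P.twist ζ w ∈ unitary (Matrix (Fin n) (Fin n) D)) (i j : Fin n) :
    P.lift ζ w hw hw' (P.u ζ i j) = w i j :=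
  CStarPresentation.lift_gen _ _ _ _

theorem u_eq : P.u ζ = (freeGen n).map (P.presentation ζ).toAlg := rfl

theorem mem_unitary_of_rel {M : Matrix (Fin n) (Fin n) (FreeStar (Fin n × Fin n))}
    (hM : M ∈ ({freeGen n, P.twist ζ (freeGen n)} : Set _)) :
    M.map (P.presentation ζ).toAlg ∈
      unitary (Matrix (Fin n) (Fin n) (P.FreeUnitaryAlg ζ)) := by
  refine ⟨sub_eq_zero.1 (Matrix.ext fun i j => ?_), sub_eq_zero.1 (Matrix.ext fun i j => ?_)⟩
  · rw [← map_star_mul_self, Matrix.zero_apply]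
    exact (P.presentation ζ).toAlg_rel ⟨M, hM, i, j, Or.inl rfl⟩
  · rw [← map_self_mul_star, Matrix.zero_apply]
    exact (P.presentation ζ).toAlg_rel ⟨M, hM, i, j, Or.inr rfl⟩

theorem u_mem_unitary : P.u ζ ∈ unitary (Matrix (Fin n) (Fin n) (P.FreeUnitaryAlg ζ)) :=
  P.mem_unitary_of_rel ζ (Or.inl rfl)

theorem twist_u_mem_unitary :
    P.twist ζ (P.u ζ) ∈ unitary (Matrix (Fin n) (Fin n) (P.FreeUnitaryAlg ζ)) := by
  rw [u_eq, ← map_twist]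
  exact P.mem_unitary_of_rel ζ (Or.inr rfl)

/-- The matrix `(M_{ij} ⊗ z ^ (c_j - c_i))`. -/
def graded {A : Type} [CStarAlgebra A] (c : Fin n → ℤ) (M : Matrix (Fin n) (Fin n) A) :
    Matrix (Fin n) (Fin n) (MinTensor A CircleAlg) :=
  Matrix.of fun i j => MinTensor.tmul (M i j) (CircleAlg.zpow (c j - c i))

theorem graded_apply {A : Type} [CStarAlgebra A] (c : Fin n → ℤ) (M : Matrix (Fin n) (Fin n) A)
    (i j : Fin n) :
    graded c M i j = MinTensor.tmul (M i j) (CircleAlg.zpow (c j - c i)) := rfl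

theorem graded_mem_unitary {A : Type} [CStarAlgebra A] (c : Fin n → ℤ)
    {M : Matrix (Fin n) (Fin n) A} (hM : M ∈ unitary (Matrix (Fin n) (Fin n) A)) :
    graded c M ∈ unitary (Matrix (Fin n) (Fin n) (MinTensor A CircleAlg)) := by
  have key (x : Fin n → A) (i j : Fin n) (hx : ∑ k, x k = (1 : Matrix (Fin n) (Fin n) A) i j) :
      ∑ k, MinTensor.tmul (x k) (CircleAlg.zpow (c j - c i)) =
        (1 : Matrix (Fin n) (Fin n) (MinTensor A CircleAlg)) i j := by
    rw [← MinTensor.sum_tmul, hx, Matrix.one_apply, Matrix.one_apply]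
    split_ifs with h
    · subst h
      rw [sub_self, CircleAlg.zpow_zero, MinTensor.one_tmul_one]
    · rw [MinTensor.zero_tmul]
  constructor
  · ext i j
    rw [← key (fun k => star (M k i) * M k j) i j (congrFun₂ hM.1 i j)]
    simp only [Matrix.mul_apply, Matrix.star_apply, graded, Matrix.of_apply, MinTensor.star_tmul,
      MinTensor.tmul_mul, CircleAlg.star_zpow, CircleAlg.zpow_mul]
    refine Finset.sum_congr rfl fun k _ => ?_
    congr 2; ring
  · ext i j
    rw [← key (fun k => M i k * star (M j k)) i j (congrFun₂ hM.2 i j)]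
    simp only [Matrix.mul_apply, Matrix.star_apply, graded, Matrix.of_apply, MinTensor.star_tmul,
      MinTensor.tmul_mul, CircleAlg.star_zpow, CircleAlg.zpow_mul]
    refine Finset.sum_congr rfl fun k _ => ?_
    congr 2; ring

theorem twist_graded {A : Type} [CStarAlgebra A] (M : Matrix (Fin n) (Fin n) A) :
    P.twist ζ (graded P.d M) = graded P.d' (P.twist ζ M) := by
  ext i j
  rw [twist_apply, graded_apply, twist_apply, MinTensor.sum_tmul]
  refine Finset.sum_congr rfl fun b _ => ?_
  rw [MinTensor.sum_tmul]
  refine Finset.sum_congr rfl fun a _ => ?_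
  rw [graded_apply, MinTensor.star_tmul, CircleAlg.star_zpow, MinTensor.smul_tmul]
  by_cases ha : -P.d a + P.e = P.d' i
  · by_cases hb : -P.d b + P.e = P.d' j
    · congr 3
      linarith
    · rw [(P.compat j b hb).2, mul_zero, zero_smul, zero_smul]
  · rw [(P.compat i a ha).1, zero_mul, zero_mul, zero_smul, zero_smul]

/-- The coaction of the circle on the braided free unitary quantum group, with
`u_{ij} ↦ u_{ij} ⊗ z ^ (d_j - d_i)`. -/
def coaction : P.FreeUnitaryAlg ζ →⋆ₐ[ℂ] MinTensor (P.FreeUnitaryAlg ζ) CircleAlg :=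
  P.lift ζ (graded P.d (P.u ζ)) (graded_mem_unitary _ (P.u_mem_unitary ζ))
    (P.twist_graded ζ (P.u ζ) ▸ graded_mem_unitary _ (P.twist_u_mem_unitary ζ))

theorem coaction_u (i j : Fin n) :
    P.coaction ζ (P.u ζ i j) = MinTensor.tmul (P.u ζ i j) (CircleAlg.zpow (P.d j - P.d i)) :=
  P.lift_u ζ _ _ _ i j

end Universal

end AdmissibleMatrix

/-! ### Compact matrix quantum groups -/

/-- A unital C*-algebra `B` with a comultiplication `Δ : B → B ⊗ B` (minimal tensor product) and a
matrix `w` over `B` form a compact matrix quantum group: the *-algebra generated by the entries of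
`w` is dense, `Δ (w_{ij}) = ∑ k, w_{ik} ⊗ w_{kj}`, and both `w` and the matrix `(w_{ij}*)` are
invertible. (`Δ` is then determined by `w` and coassociative.) -/
structure IsCompactMatrixQuantumGroup {B N : Type} [CStarAlgebra B] [Fintype N] [DecidableEq N]
    (Δ : B →⋆ₐ[ℂ] MinTensor B B) (w : Matrix N N B) : Prop where
  dense : (StarAlgebra.adjoin ℂ (Set.range fun p : N × N => w p.1 p.2)).topologicalClosure = ⊤
  comul : ∀ i j, Δ (w i j) = ∑ k, MinTensor.tmul (w i k) (w k j)
  isUnit : IsUnit w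
  isUnit_conj : IsUnit (w.map star)

/-- A matrix `t` over `B` is a finite dimensional unitary representation of `(B, Δ)`. -/
structure IsUnitaryRepresentation {B N : Type} [CStarAlgebra B] [Fintype N] [DecidableEq N]
    (Δ : B →⋆ₐ[ℂ] MinTensor B B) (t : Matrix N N B) : Prop where
  mem_unitary : t ∈ unitary (Matrix N N B)
  comul : ∀ i j, Δ (t i j) = ∑ k, MinTensor.tmul (t i k) (t k j)

/-! ### The bosonization -/

namespace AdmissibleMatrix

variable {n : ℕ} (P : AdmissibleMatrix n) (ζ : Circle)

/-- The braided tensor square `A ⊠_ζ A` of `A = C(U_ζ⁺(F))`. -/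
abbrev BraidedSquare : Type := Braided ζ (P.coaction ζ) (P.coaction ζ)

/-- The C*-algebra `C(𝕋) ⊠_ζ C(U_ζ⁺(F))` of the bosonization. -/
abbrev BosonizationAlg : Type := Braided ζ CircleAlg.comul (P.coaction ζ)

/-- `j₁ : C(𝕋) → C(𝕋) ⊠_ζ C(U_ζ⁺(F))`. -/
abbrev J₁ : CircleAlg →⋆ₐ[ℂ] P.BosonizationAlg ζ := Braided.j₁ ζ CircleAlg.comul (P.coaction ζ)

/-- `j₂ : C(U_ζ⁺(F)) → C(𝕋) ⊠_ζ C(U_ζ⁺(F))`. -/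
abbrev J₂ : P.FreeUnitaryAlg ζ →⋆ₐ[ℂ] P.BosonizationAlg ζ :=
  Braided.j₂ ζ CircleAlg.comul (P.coaction ζ)

/-- The comultiplication of the bosonization, `ψ ∘ (id ⊠_ζ Δ)`, with the morphisms that it is
made of. Each of them is determined by the equations. -/
structure BosonizationComul where
  /-- The coaction of the circle on `A ⊠_ζ A` for which `j₁` and `j₂` are equivariant. -/
  δ : P.BraidedSquare ζ →⋆ₐ[ℂ] MinTensor (P.BraidedSquare ζ) CircleAlg
  δ_j₁ : ∀ a, δ (Braided.j₁ ζ (P.coaction ζ) (P.coaction ζ) a) =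
    MinTensor.map (Braided.j₁ ζ (P.coaction ζ) (P.coaction ζ)) (StarAlgHom.id ℂ CircleAlg)
      (P.coaction ζ a)
  δ_j₂ : ∀ a, δ (Braided.j₂ ζ (P.coaction ζ) (P.coaction ζ) a) =
    MinTensor.map (Braided.j₂ ζ (P.coaction ζ) (P.coaction ζ)) (StarAlgHom.id ℂ CircleAlg)
      (P.coaction ζ a)
  /-- The comultiplication of the braided free unitary quantum group. -/
  ΔG : P.FreeUnitaryAlg ζ →⋆ₐ[ℂ] P.BraidedSquare ζ
  ΔG_u : ∀ i j, ΔG (P.u ζ i j) = ∑ k, Braided.j₁ ζ (P.coaction ζ) (P.coaction ζ) (P.u ζ i k) *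
    Braided.j₂ ζ (P.coaction ζ) (P.coaction ζ) (P.u ζ k j)
  /-- The morphism `id ⊠_ζ Δ : C(𝕋) ⊠_ζ A → C(𝕋) ⊠_ζ (A ⊠_ζ A)`. -/
  idΔ : P.BosonizationAlg ζ →⋆ₐ[ℂ] Braided ζ CircleAlg.comul δ
  idΔ_mul : ∀ x a, idΔ (P.J₁ ζ x * P.J₂ ζ a) =
    Braided.j₁ ζ CircleAlg.comul δ x * Braided.j₂ ζ CircleAlg.comul δ (ΔG a)
  /-- The morphism `ψ : C(𝕋) ⊠_ζ A ⊠_ζ A → (C(𝕋) ⊠_ζ A) ⊗ (C(𝕋) ⊠_ζ A)`. -/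
  ψ : Braided ζ CircleAlg.comul δ →⋆ₐ[ℂ] MinTensor (P.BosonizationAlg ζ) (P.BosonizationAlg ζ)
  ψ_j₁ : ∀ x, ψ (Braided.j₁ ζ CircleAlg.comul δ x) =
    MinTensor.map (P.J₁ ζ) (P.J₁ ζ) (CircleAlg.comul x)
  ψ_j₂ : ∀ a, ψ (Braided.j₂ ζ CircleAlg.comul δ
      (Braided.j₁ ζ (P.coaction ζ) (P.coaction ζ) a)) =
    MinTensor.map (P.J₂ ζ) (P.J₁ ζ) (P.coaction ζ a)
  ψ_j₃ : ∀ b, ψ (Braided.j₂ ζ CircleAlg.comul δ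
      (Braided.j₂ ζ (P.coaction ζ) (P.coaction ζ) b)) = MinTensor.tmul 1 (P.J₂ ζ b)

/-- The comultiplication of the bosonization. -/
def BosonizationComul.comul {P : AdmissibleMatrix n} {ζ : Circle} (𝔅 : P.BosonizationComul ζ) :
    P.BosonizationAlg ζ →⋆ₐ[ℂ] MinTensor (P.BosonizationAlg ζ) (P.BosonizationAlg ζ) :=
  𝔅.ψ.comp 𝔅.idΔ

/-- The matrix `t`, with `t_{ij} = j₁ (z ^ d_i) j₂ (u_{ij})`. -/
def t : Matrix (Fin n) (Fin n) (P.BosonizationAlg ζ) :=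
  Matrix.of fun i j => P.J₁ ζ (CircleAlg.zpow (P.d i)) * P.J₂ ζ (P.u ζ i j)

/-- The matrix `z ⊕ t`. -/
def zt : Matrix (Unit ⊕ Fin n) (Unit ⊕ Fin n) (P.BosonizationAlg ζ) :=
  Matrix.fromBlocks (Matrix.of fun _ _ => P.J₁ ζ CircleAlg.z) 0 0 (P.t ζ)

end AdmissibleMatrix

end

open scoped TensorProduct

noncomputable section

/-! ### Generating families and existence of *-homomorphisms -/

/-! The algebra `A` has a universal property, but a braided tensor product is a concrete
C*-subalgebra of a minimal tensor product, so *-homomorphisms out of it must be earned. The basic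
criterion is `Generates.exists_hom`: an assignment on generators extends as soon as it does not
increase norms of *-polynomials. Norms in the targets are tested in representations on Hilbert
spaces (`HasNormingReps`), which the minimal norm supplies by its definition, or, in a tensor
product with `C(𝕋)`, by evaluating at the points of the circle (`MinTensor.norm_le_of_slice`).

The analytic core is `Braided.exists_hom`. Suppose that `τ` maps `X ⊗ Y` to operators on `L`, and
that a unitary `W = h(z)` commutes with `τ(x ⊗ 1)` and satisfies `τ(1 ⊗ y) W = ζ^l W τ(1 ⊗ y)` for
`y` of degree `l`. Then `j₁ x ↦ τ(x ⊗ 1) W^k`, `j₂ y ↦ τ(1 ⊗ y)` should be a *-homomorphism of `X ⊠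
Y`. Let `U`, `V` act on `ℓ²(ℤ)` by a shift and by phases. The vectors `∑ W^s v ⊗ e_s`, summed over
`0 ≤ s < N`, have norm `√N ‖v‖`, and up to an error bounded independently of `N` they intertwine the
prescribed operators on `L` with those of `X ⊠ Y` on `L ⊗ ℓ²(ℤ)`. Dividing by `√N` gives the norm
inequality for every *-polynomial; this is the amenability of `ℤ`.

The morphism `ψ` comes from two applications of this result: one for the second and third legs
(`exists_hom_square`), one that attaches the first leg. The coaction on `A ⊠ A` is assembled from
gauge maps `U ↦ wU`, `V ↦ wV`, and `id ⊠ Δ` is the restriction of a homomorphism of the ambient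
tensor products. The braided `Δ` exists because the twisted conjugate is multiplicative on matrices
whose entries braid (`conj_mul`).

The rest is bookkeeping of exponents. The matrix `t` is a diagonal unitary times `j₂(u)`, hence
unitary. The factor `j₁(z^{d_i})` absorbs the degree shift that `ψ` puts on the second leg, and
moving it past `j₂(u_ij*)` produces exactly the phase in `ū_ζ`, which is conjugate under `F` to a
unitary matrix. -/

theorem FreeStar.induct_gen {G : Type} {P : FreeStar G → Prop}
    (halg : ∀ c, P (algebraMap ℂ _ c)) (hgen : ∀ g, P (FreeStar.gen g))
    (hstar : ∀ g, P (star (FreeStar.gen g))) (hadd : ∀ x y, P x → P y → P (x + y))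
    (hmul : ∀ x y, P x → P y → P (x * y)) (x : FreeStar G) : P x := by
  induction x using FreeStar.induct with
  | h0 => simpa using halg 0
  | hadd x y hx hy => exact hadd x y hx hy
  | hm m c =>
    induction m using FreeMonoid.recOn with
    | one => rw [FreeStar.monom_one]; exact halg c
    | of_mul a m hm =>
      rw [FreeStar.monom_cons]
      refine hmul _ _ ?_ hm
      split_ifs
      · exact hstar _
      · exact hgen _

/-- The closed *-subalgebra generated by the family `e` is everything. -/
def Generates {C I : Type} [CStarAlgebra C] (e : I → C) : Prop :=
  (StarAlgebra.adjoin ℂ (Set.range e)).topologicalClosure = ⊤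

section Generates

variable {C D I : Type} [CStarAlgebra C] [CStarAlgebra D] {e : I → C}

theorem continuous_starAlgHom (φ : C →⋆ₐ[ℂ] D) : Continuous φ :=
  AddMonoidHomClass.continuous_of_bound φ 1 fun x => by
    rw [one_mul]; exact NonUnitalStarAlgHom.norm_apply_le φ x

theorem norm_starAlgHom_le (φ : C →⋆ₐ[ℂ] D) (x : C) : ‖φ x‖ ≤ ‖x‖ :=
  NonUnitalStarAlgHom.norm_apply_le φ x

theorem norm_starAlgHom_of_injective (φ : C →⋆ₐ[ℂ] D) (h : Function.Injective φ) (x : C) :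
    ‖φ x‖ = ‖x‖ :=
  NonUnitalStarAlgHom.norm_map φ h x

theorem Generates.mem (he : Generates e) {T : StarSubalgebra ℂ C} (hT : IsClosed (T : Set C))
    (h : ∀ i, e i ∈ T) (c : C) : c ∈ T := by
  have h1 : (StarAlgebra.adjoin ℂ (Set.range e)).topologicalClosure ≤ T :=
    StarSubalgebra.topologicalClosure_minimal
      (StarAlgebra.adjoin_le (Set.range_subset_iff.2 h)) hT
  rw [he] at h1
  exact h1 StarSubalgebra.mem_top

theorem generates_of_forall_mem
    (h : ∀ T : StarSubalgebra ℂ C, IsClosed (T : Set C) → (∀ i, e i ∈ T) → ∀ c, c ∈ T) :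
    Generates e :=
  eq_top_iff.2 fun c _ => h _ (StarSubalgebra.isClosed_topologicalClosure _)
    (fun i => StarSubalgebra.le_topologicalClosure _ (StarAlgebra.subset_adjoin ℂ _
      (Set.mem_range_self i))) c

theorem isClosed_comap (φ : C →⋆ₐ[ℂ] D) {T : StarSubalgebra ℂ D} (hT : IsClosed (T : Set D)) :
    IsClosed (T.comap φ : Set C) :=
  hT.preimage (continuous_starAlgHom φ)

theorem Generates.map_mem (he : Generates e) (φ : C →⋆ₐ[ℂ] D) {T : StarSubalgebra ℂ D}
    (hT : IsClosed (T : Set D)) (h : ∀ i, φ (e i) ∈ T) (c : C) : φ c ∈ T :=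
  he.mem (isClosed_comap φ hT) h c

theorem Generates.hom_ext (he : Generates e) {φ ψ : C →⋆ₐ[ℂ] D} (h : ∀ i, φ (e i) = ψ (e i)) :
    φ = ψ := by
  ext c
  exact he.mem (T := StarAlgHom.equalizer φ ψ)
    (isClosed_eq (continuous_starAlgHom φ) (continuous_starAlgHom ψ)) h c

/-- An injective *-homomorphism of C*-algebras is isometric, so its range is closed and contains
everything that the generators generate. -/
theorem Generates.surjective_of_injective (he : Generates e) {E : Type} [CStarAlgebra E] (φ : E →⋆ₐ[ℂ] C)
    (hφ : Function.Injective φ) (h : ∀ i, e i ∈ φ.range) : Function.Surjective φ := by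
  refine fun c => he.mem (T := φ.range) ?_ h c
  have := (NonUnitalStarAlgHom.isometry φ hφ).isClosedEmbedding.isClosed_range
  exact this

/-- A map of a generating family to a C*-algebra extends to a *-homomorphism if it does not
increase the norms of *-polynomials. -/
theorem Generates.exists_hom (he : Generates e) (q : I → D)
    (h : ∀ p : FreeStar I, ‖FreeStar.eval q p‖ ≤ ‖FreeStar.eval e p‖) :
    ∃ Θ : C →⋆ₐ[ℂ] D, ∀ i, Θ (e i) = q i := by
  -- Completing the free *-algebra for `‖p(e)‖` gives an isometric copy of `C` through `E`. The
  -- hypothesis lets evaluation at `q` extend to the same completion, and `Θ = Q ∘ E⁻¹`.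
  let s : CStarSeminorm (FreeStar I) := CStarSeminorm.ofHom (FreeStar.eval e)
  let E : s.Completion →⋆ₐ[ℂ] C := CStarSeminorm.lift (FreeStar.eval e) fun _ => le_rfl
  let Q : s.Completion →⋆ₐ[ℂ] D := CStarSeminorm.lift (FreeStar.eval q) h
  have hE (p) : E (s.toCompletion p) = FreeStar.eval e p := CStarSeminorm.lift_toCompletion _ _ _
  have hQ (p) : Q (s.toCompletion p) = FreeStar.eval q p := CStarSeminorm.lift_toCompletion _ _ _
  have hn (x : s.Completion) : ‖E x‖ = ‖x‖ := by
    induction x using s.toCompletion_induction with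
    | hP => exact isClosed_eq (continuous_starAlgHom E).norm continuous_norm
    | h p => rw [hE, s.norm_toCompletion]; rfl
  have hi : Function.Injective E := (injective_iff_map_eq_zero E).2 fun x hx => by
    rw [← norm_eq_zero, ← hn, hx, norm_zero]
  have hs : Function.Surjective E := he.surjective_of_injective E hi fun i =>
    ⟨s.toCompletion (FreeStar.gen i), (hE _).trans (FreeStar.eval_gen e i)⟩
  let E' := StarAlgEquiv.ofBijective E ⟨hi, hs⟩
  refine ⟨Q.comp (E'.symm : C →⋆ₐ[ℂ] s.Completion), fun i => ?_⟩
  have : E'.symm (e i) = s.toCompletion (FreeStar.gen i) := by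
    rw [StarAlgEquiv.symm_apply_eq]
    exact ((hE _).trans (FreeStar.eval_gen e i)).symm
  change Q (E'.symm (e i)) = _
  rw [this, hQ, FreeStar.eval_gen]

end Generates

theorem CStarPresentation.generates {G : Type} (R : CStarPresentation G) : Generates R.gen := by
  refine generates_of_forall_mem fun T hT h c => ?_
  refine R.maxSeminorm.toCompletion_induction (P := fun c => c ∈ T) c hT fun p => ?_
  change R.toAlg p ∈ T
  induction p using FreeStar.induct_gen with
  | halg c => rw [AlgHomClass.commutes]; exact T.algebraMap_mem c
  | hgen g => exact h g
  | hstar g => rw [map_star]; exact star_mem (h g)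
  | hadd x y hx hy => rw [map_add]; exact add_mem hx hy
  | hmul x y hx hy => rw [map_mul]; exact mul_mem hx hy

theorem AdmissibleMatrix.generates_u {n : ℕ} (P : AdmissibleMatrix n) (ζ : Circle) :
    Generates fun g : Fin n × Fin n => P.u ζ g.1 g.2 :=
  (P.presentation ζ).generates

/-- Stone–Weierstrass: `z` separates the points of the circle. -/
theorem CircleAlg.generates_z : Generates fun _ : Unit => CircleAlg.z := by
  refine ContinuousMap.starSubalgebra_topologicalClosure_eq_top_of_separatesPoints _ ?_
  intro x y hxy
  refine ⟨CircleAlg.z, ⟨CircleAlg.z, StarAlgebra.subset_adjoin ℂ _ ⟨(), rfl⟩, rfl⟩, ?_⟩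
  simpa [CircleAlg.z, CircleAlg.zpow, Circle.coe_inj] using hxy

theorem Braided.generates (ζ : Circle) {X Y I J : Type} [CStarAlgebra X] [CStarAlgebra Y]
    (ρX : X →⋆ₐ[ℂ] MinTensor X CircleAlg) (ρY : Y →⋆ₐ[ℂ] MinTensor Y CircleAlg)
    {x : I → X} {y : J → Y} (hx : Generates x) (hy : Generates y) :
    Generates (Sum.elim (fun i => Braided.j₁ ζ ρX ρY (x i)) fun j => Braided.j₂ ζ ρX ρY (y j)) := by
  refine generates_of_forall_mem fun T hT h => ?_
  have h1 (a : X) : Braided.j₁ ζ ρX ρY a ∈ T := hx.map_mem _ hT (fun i => h (Sum.inl i)) a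
  have h2 (b : Y) : Braided.j₂ ζ ρX ρY b ∈ T := hy.map_mem _ hT (fun i => h (Sum.inr i)) b
  let S := Braided.carrier ζ ρX ρY
  have hS : IsClosed (S : Set (MinTensor (MinTensor X Y) (TorusAlg ζ))) :=
    StarSubalgebra.isClosed_topologicalClosure _
  -- The density argument takes place in the ambient tensor product: the carrier is closed there, so
  -- the image of `T` is closed as well and must contain the whole carrier.
  let T' : StarSubalgebra ℂ (MinTensor (MinTensor X Y) (TorusAlg ζ)) :=
    StarSubalgebra.map S.subtype T
  have hT' : IsClosed (T' : Set (MinTensor (MinTensor X Y) (TorusAlg ζ))) :=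
    hS.isClosedEmbedding_subtypeVal.isClosedMap _ hT
  have key : S ≤ T' := StarSubalgebra.topologicalClosure_minimal (StarAlgebra.adjoin_le (by
    rintro _ (⟨a, rfl⟩ | ⟨b, rfl⟩)
    · exact ⟨_, h1 a, rfl⟩
    · exact ⟨_, h2 b, rfl⟩)) hT'
  intro c
  obtain ⟨c', hc', hcc⟩ := key c.2
  exact Subtype.ext (a1 := c') (a2 := c) hcc ▸ hc'

/-! ### Spatial representations -/

namespace MinTensor

/-! ### Hilbert space completions of inner product spaces -/

section Completion

open UniformSpace

variable {V : Type} [NormedAddCommGroup V] [InnerProductSpace ℂ V]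

/-- The Hilbert space completion of an inner product space. -/
def Hilbert (V : Type) [NormedAddCommGroup V] [InnerProductSpace ℂ V] : Type := Completion V

instance : NormedAddCommGroup (Hilbert V) := inferInstanceAs (NormedAddCommGroup (Completion V))
instance : InnerProductSpace ℂ (Hilbert V) := inferInstanceAs (InnerProductSpace ℂ (Completion V))
instance : CompleteSpace (Hilbert V) := inferInstanceAs (CompleteSpace (Completion V))

variable (V) in
/-- The inclusion of an inner product space in its completion. -/
def toHilbert : V →ₗᵢ[ℂ] Hilbert V where
  toFun v := (v : Completion V)
  map_add' := Completion.coe_add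
  map_smul' c v := Completion.coe_smul c v
  norm_map' v := Completion.norm_coe v

theorem hilbert_induction {P : Hilbert V → Prop} (x : Hilbert V) (hP : IsClosed {x | P x})
    (h : ∀ v, P (toHilbert V v)) : P x :=
  Completion.induction_on x hP h

theorem denseRange_toHilbert : DenseRange (toHilbert V).toContinuousLinearMap :=
  Completion.denseRange_coe

theorem isUniformInducing_toHilbert : IsUniformInducing (toHilbert V).toContinuousLinearMap :=
  Completion.isUniformInducing_coe V

/-- The extension of a bounded operator to the completion. -/
def completionL (f : V →L[ℂ] V) : Hilbert V →L[ℂ] Hilbert V :=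
  ContinuousLinearMap.extend ((toHilbert V).toContinuousLinearMap ∘L f)
    (toHilbert V).toContinuousLinearMap

theorem completionL_coe (f : V →L[ℂ] V) (v : V) :
    completionL f (toHilbert V v) = toHilbert V (f v) :=
  ContinuousLinearMap.extend_eq ((toHilbert V).toContinuousLinearMap ∘L f) denseRange_toHilbert
    isUniformInducing_toHilbert v

theorem completionL_unique {f : V →L[ℂ] V} {g : Hilbert V →L[ℂ] Hilbert V}
    (h : ∀ v : V, g (toHilbert V v) = toHilbert V (f v)) : completionL f = g :=
  ContinuousLinearMap.extend_unique ((toHilbert V).toContinuousLinearMap ∘L f) denseRange_toHilbert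
    isUniformInducing_toHilbert g (ContinuousLinearMap.ext h)

/-- Completing is harmless: it replaces the algebraic tensor product of Hilbert spaces, whose
operators need not form a C*-algebra, by a Hilbert space, and leaves the spatial seminorms
unchanged. -/
theorem norm_completionL (f : V →L[ℂ] V) : ‖completionL f‖ = ‖f‖ := by
  refine le_antisymm (ContinuousLinearMap.opNorm_le_bound _ (norm_nonneg _) fun x => ?_)
    (ContinuousLinearMap.opNorm_le_bound _ (norm_nonneg _) fun x => ?_)
  · induction x using hilbert_induction with
    | hP => exact isClosed_le (by fun_prop) (by fun_prop)
    | h v =>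
      rw [completionL_coe, LinearIsometry.norm_map, LinearIsometry.norm_map]
      exact f.le_opNorm v
  · have := (completionL f).le_opNorm (toHilbert V x)
    rwa [completionL_coe, LinearIsometry.norm_map, LinearIsometry.norm_map] at this

end Completion

section Spatial

variable {A B H K : Type} [CStarAlgebra A] [CStarAlgebra B]
  [NormedAddCommGroup H] [InnerProductSpace ℂ H] [CompleteSpace H]
  [NormedAddCommGroup K] [InnerProductSpace ℂ K] [CompleteSpace K]

/-- The representation of the algebraic tensor product on the Hilbert space tensor product. -/
def spatialHatAlg (π : A →⋆ₐ[ℂ] (H →L[ℂ] H)) (σ : B →⋆ₐ[ℂ] (K →L[ℂ] K)) :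
    (A ⊗[ℂ] B) →⋆ₐ[ℂ] (Hilbert (H ⊗[ℂ] K) →L[ℂ] Hilbert (H ⊗[ℂ] K)) where
  toFun t := completionL (spatialRep π σ t)
  map_one' := completionL_unique fun v => by rw [map_one]; rfl
  map_zero' := completionL_unique fun v => by
    rw [map_zero]; exact (map_zero (toHilbert _)).symm
  map_mul' x y := completionL_unique fun v => by
    rw [map_mul, mul_apply_eq_comp, completionL_coe, completionL_coe]; rfl
  map_add' x y := completionL_unique fun v => by
    rw [map_add, add_apply, completionL_coe, completionL_coe]
    exact (map_add (toHilbert _) _ _).symm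
  commutes' c := completionL_unique fun v => by
    rw [AlgHom.commutes]; exact (map_smul (toHilbert _) c v).symm
  map_star' x := by
    refine (ContinuousLinearMap.eq_adjoint_iff _ _).2 fun v w => ?_
    induction v using hilbert_induction with
    | hP => exact isClosed_eq (by fun_prop) (by fun_prop)
    | h v =>
      induction w using hilbert_induction with
      | hP => exact isClosed_eq (by fun_prop) (by fun_prop)
      | h w =>
        rw [completionL_coe, completionL_coe, LinearIsometry.inner_map_map,
          LinearIsometry.inner_map_map, inner_spatialRep, star_star]

theorem norm_spatialHatAlg_le (π : A →⋆ₐ[ℂ] (H →L[ℂ] H)) (σ : B →⋆ₐ[ℂ] (K →L[ℂ] K))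
    (t : A ⊗[ℂ] B) : ‖spatialHatAlg π σ t‖ ≤ minSeminorm A B t :=
  (norm_completionL _).le.trans (le_csSup (bddAbove_spatialSeminorms t)
    ⟨spatialSeminorm π σ, ⟨H, K, _, _, _, _, _, _, _, _, rfl⟩, rfl⟩)

/-- The representation `π ⊗ σ` of the minimal tensor product on the Hilbert space tensor
product. -/
def spatialHat (π : A →⋆ₐ[ℂ] (H →L[ℂ] H)) (σ : B →⋆ₐ[ℂ] (K →L[ℂ] K)) :
    MinTensor A B →⋆ₐ[ℂ] (Hilbert (H ⊗[ℂ] K) →L[ℂ] Hilbert (H ⊗[ℂ] K)) :=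
  CStarSeminorm.lift (p := minSeminorm A B) (spatialHatAlg π σ) (norm_spatialHatAlg_le π σ)

theorem spatialHat_eq (π : A →⋆ₐ[ℂ] (H →L[ℂ] H)) (σ : B →⋆ₐ[ℂ] (K →L[ℂ] K)) (t : A ⊗[ℂ] B) :
    spatialHat π σ (ofAlg A B t) = completionL (spatialRep π σ t) :=
  CStarSeminorm.lift_toCompletion (p := minSeminorm A B) (spatialHatAlg π σ)
    (norm_spatialHatAlg_le π σ) t

theorem spatialHat_tmul (π : A →⋆ₐ[ℂ] (H →L[ℂ] H)) (σ : B →⋆ₐ[ℂ] (K →L[ℂ] K)) (a : A) (b : B)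
    (h : H) (k : K) :
    spatialHat π σ (tmul a b) (toHilbert _ (h ⊗ₜ[ℂ] k)) =
      toHilbert _ (π a h ⊗ₜ[ℂ] σ b k) := by
  rw [tmul, spatialHat_eq, completionL_coe, spatialRep_tmul]
  rfl

end Spatial

variable {A B D : Type} [CStarAlgebra A] [CStarAlgebra B] [CStarAlgebra D]

theorem induction_approx {P : MinTensor A B → Prop} (d : MinTensor A B) (hP : IsClosed {d | P d})
    (h : ∀ t, P (ofAlg A B t)) : P d :=
  (minSeminorm A B).toCompletion_induction d hP h

theorem exists_approx (d : MinTensor A B) {ε : ℝ} (hε : 0 < ε) :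
    ∃ t, ‖d - ofAlg A B t‖ < ε := by
  have : d ∈ closure (Set.range (ofAlg A B)) :=
    induction_approx (P := fun d => d ∈ closure (Set.range (ofAlg A B))) d isClosed_closure
      fun t => subset_closure ⟨t, rfl⟩
  obtain ⟨_, ⟨t, rfl⟩, ht⟩ := Metric.mem_closure_iff.1 this ε hε
  exact ⟨t, by rwa [← dist_eq_norm]⟩

theorem norm_tmul_le (a : A) (b : B) : ‖tmul a b‖ ≤ ‖a‖ * ‖b‖ := by
  have : tmul a b = inl A B a * inr A B b := by
    rw [inl_apply, inr_apply, tmul_mul, mul_one, one_mul]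
  rw [this]
  exact (norm_mul_le _ _).trans (mul_le_mul (norm_starAlgHom_le _ _) (norm_starAlgHom_le _ _)
    (norm_nonneg _) (norm_nonneg _))

theorem tmul_eq (a : A) (b : B) : tmul a b = inl A B a * inr A B b := by
  rw [inl_apply, inr_apply, tmul_mul, mul_one, one_mul]

end MinTensor

/-- The norm of a C*-algebra is the supremum of the norms in its representations on (small)
Hilbert spaces. -/
def HasNormingReps (D : Type) [CStarAlgebra D] : Prop :=
  ∀ (d : D) (C : ℝ), (∀ (L : Type) (_ : NormedAddCommGroup L) (_ : InnerProductSpace ℂ L)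
    (_ : CompleteSpace L) (ω : D →⋆ₐ[ℂ] (L →L[ℂ] L)), ‖ω d‖ ≤ C) → ‖d‖ ≤ C

theorem HasNormingReps.of_injective {D E : Type} [CStarAlgebra D] [CStarAlgebra E]
    (hE : HasNormingReps E) (φ : D →⋆ₐ[ℂ] E) (hφ : Function.Injective φ) : HasNormingReps D := by
  intro d C h
  rw [← norm_starAlgHom_of_injective φ hφ]
  exact hE _ _ fun L _ _ _ ω => h L _ _ _ (ω.comp φ)

/-- The minimal norm is a supremum of spatial seminorms, each of which is the norm in an actual
representation `spatialHat π σ`. Approximation by the algebraic tensor product handles the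
completion, and no GNS construction is needed. -/
theorem MinTensor.hasNormingReps (A B : Type) [CStarAlgebra A] [CStarAlgebra B] :
    HasNormingReps (MinTensor A B) := by
  intro d C h
  -- The zero Hilbert space carries a representation, which forces `C ≥ 0`; bounding a real supremum
  -- below requires this sign.
  have hC : 0 ≤ C := (norm_nonneg _).trans (h PUnit _ _ inferInstance
    { toFun := fun _ => 0, map_one' := Subsingleton.elim _ _, map_mul' := fun _ _ => by simp,
      map_zero' := rfl, map_add' := fun _ _ => by simp, commutes' := fun _ => Subsingleton.elim _ _,
      map_star' := fun _ => by simp })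
  refine le_of_forall_pos_le_add fun ε hε => ?_
  obtain ⟨t, ht⟩ := exists_approx d (half_pos hε)
  have h1 : ‖ofAlg A B t‖ ≤ C + ε / 2 := by
    rw [norm_ofAlg]
    refine Real.sSup_le ?_ (by positivity)
    rintro _ ⟨_, ⟨H, K, _, _, _, _, _, _, π, σ, rfl⟩, rfl⟩
    refine ((congrArg norm (spatialHat_eq π σ t)).trans (norm_completionL _)).symm.le.trans ?_
    have h2 := h _ _ _ inferInstance (spatialHat π σ)
    have h3 := (norm_starAlgHom_le (spatialHat π σ) (d - ofAlg A B t)).trans ht.le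
    rw [map_sub] at h3
    have h4 := norm_sub_norm_le (spatialHat π σ (ofAlg A B t)) (spatialHat π σ d)
    rw [norm_sub_rev] at h4
    linarith
  have h5 := norm_sub_norm_le d (ofAlg A B t)
  linarith

theorem Braided.incl_injective (ζ : Circle) {X Y : Type} [CStarAlgebra X] [CStarAlgebra Y]
    (ρX : X →⋆ₐ[ℂ] MinTensor X CircleAlg) (ρY : Y →⋆ₐ[ℂ] MinTensor Y CircleAlg) :
    Function.Injective (Braided.incl ζ ρX ρY) :=
  Subtype.val_injective

theorem Braided.hasNormingReps (ζ : Circle) {X Y : Type} [CStarAlgebra X] [CStarAlgebra Y]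
    (ρX : X →⋆ₐ[ℂ] MinTensor X CircleAlg) (ρY : Y →⋆ₐ[ℂ] MinTensor Y CircleAlg) :
    HasNormingReps (Braided ζ ρX ρY) :=
  (MinTensor.hasNormingReps _ _).of_injective _ (Braided.incl_injective ζ ρX ρY)

/-! ### Slice maps -/

namespace MinTensor

variable {A B D : Type} [CStarAlgebra A] [CStarAlgebra B] [CStarAlgebra D]

/-- The product of two *-homomorphisms with commuting ranges, on the algebraic tensor product. -/
def productAlg (f : A →⋆ₐ[ℂ] D) (g : B →⋆ₐ[ℂ] D) (h : ∀ a b, Commute (f a) (g b)) :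
    (A ⊗[ℂ] B) →⋆ₐ[ℂ] D where
  __ := Algebra.TensorProduct.lift f.toAlgHom g.toAlgHom h
  map_star' x := by
    change Algebra.TensorProduct.lift f.toAlgHom g.toAlgHom h (star x) =
      star (Algebra.TensorProduct.lift f.toAlgHom g.toAlgHom h x)
    induction x using TensorProduct.induction_on with
    | zero => simp
    | tmul a b =>
      rw [TensorProduct.star_tmul, Algebra.TensorProduct.lift_tmul,
        Algebra.TensorProduct.lift_tmul, star_mul]
      exact (congrArg₂ _ (map_star f a) (map_star g b)).trans
        ((h a b).star_star).eq
    | add x y hx hy => rw [star_add, map_add, map_add, star_add, hx, hy]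

theorem productAlg_tmul (f : A →⋆ₐ[ℂ] D) (g : B →⋆ₐ[ℂ] D) (h : ∀ a b, Commute (f a) (g b))
    (a : A) (b : B) : productAlg f g h (a ⊗ₜ b) = f a * g b :=
  Algebra.TensorProduct.lift_tmul f.toAlgHom g.toAlgHom h a b

/-- Commuting *-homomorphisms to `D` induce one on the minimal tensor product if all
representations of `D` are contained in spatial ones. -/
theorem exists_product (hD : HasNormingReps D) (f : A →⋆ₐ[ℂ] D) (g : B →⋆ₐ[ℂ] D)
    (h : ∀ a b, Commute (f a) (g b))
    (hrep : ∀ (L : Type) (_ : NormedAddCommGroup L) (_ : InnerProductSpace ℂ L)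
      (_ : CompleteSpace L) (ω : D →⋆ₐ[ℂ] (L →L[ℂ] L)),
      ∃ (H K : Type) (_ : NormedAddCommGroup H) (_ : InnerProductSpace ℂ H) (_ : CompleteSpace H)
        (_ : NormedAddCommGroup K) (_ : InnerProductSpace ℂ K) (_ : CompleteSpace K)
        (π : A →⋆ₐ[ℂ] (H →L[ℂ] H)) (σ : B →⋆ₐ[ℂ] (K →L[ℂ] K)) (J : L →ₗᵢ[ℂ] (H ⊗[ℂ] K)),
        ∀ a b v, spatialRep π σ (a ⊗ₜ b) (J v) = J (ω (f a * g b) v)) :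
    ∃ τ : MinTensor A B →⋆ₐ[ℂ] D, ∀ a b, τ (tmul a b) = f a * g b := by
  refine ⟨CStarSeminorm.lift (p := minSeminorm A B) (productAlg f g h) fun t => ?_, fun a b =>
    (CStarSeminorm.lift_toCompletion _ _ _).trans (productAlg_tmul f g h a b)⟩
  refine hD _ _ fun L _ _ _ ω => ?_
  obtain ⟨H, K, _, _, _, _, _, _, π, σ, J, hJ⟩ := hrep L _ _ _ ω
  -- The isometry `J` intertwines `ω` of the product with a spatial representation, so
  -- `‖ω(productAlg t)‖` is at most a spatial seminorm of `t`.
  have key (t : A ⊗[ℂ] B) (v : L) :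
      spatialRep π σ t (J v) = J (ω (productAlg f g h t) v) := by
    induction t using TensorProduct.induction_on with
    | zero => simp
    | tmul a b => rw [hJ, productAlg_tmul]
    | add x y hx hy => rw [map_add, map_add, map_add, add_apply, add_apply, map_add, hx, hy]
  refine ContinuousLinearMap.opNorm_le_bound _ (apply_nonneg (minSeminorm A B).toSeminorm _)
    fun v => ?_
  rw [← J.norm_map, ← key, ← J.norm_map v]
  refine ((spatialRep π σ t).le_opNorm _).trans
    (mul_le_mul_of_nonneg_right ?_ (norm_nonneg _))
  exact le_csSup (bddAbove_spatialSeminorms t)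
    ⟨spatialSeminorm π σ, ⟨H, K, _, _, _, _, _, _, _, _, rfl⟩, rfl⟩

theorem algebraMap_character_apply (χ : A →⋆ₐ[ℂ] ℂ) (a : A) :
    (StarAlgHom.ofId ℂ D).comp χ a = algebraMap ℂ D (χ a) := rfl

/-- For a representation `ω` of `D` on `L`, the map `v ↦ v ⊗ 1` embeds it in the spatial
representation of `ω ∘ f` and `χ` on `L ⊗ ℂ`. With `χ` a point evaluation these are the slices of `Y
⊗ C(𝕋)`. -/
theorem exists_slice_right (hD : HasNormingReps D) (f : A →⋆ₐ[ℂ] D) (χ : B →⋆ₐ[ℂ] ℂ) :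
    ∃ τ : MinTensor A B →⋆ₐ[ℂ] D, ∀ a b, τ (tmul a b) = χ b • f a := by
  obtain ⟨τ, hτ⟩ := exists_product hD f ((StarAlgHom.ofId ℂ D).comp χ)
    (fun a b => Algebra.commute_algebraMap_right (χ b) (f a)) fun L _ _ _ ω =>
      ⟨L, ℂ, _, _, inferInstance, _, _, inferInstance, ω.comp f,
        (StarAlgHom.ofId ℂ (ℂ →L[ℂ] ℂ)).comp χ,
        (TensorProduct.commIsometry ℂ ℂ L).toLinearIsometry.comp
          (TensorProduct.lidIsometry ℂ L).symm.toLinearIsometry, fun a b v => by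
        rw [spatialRep_tmul]
        change ω (f a) v ⊗ₜ[ℂ] (χ b • (1 : ℂ)) = ω (f a * algebraMap ℂ D (χ b)) v ⊗ₜ[ℂ] (1 : ℂ)
        rw [TensorProduct.tmul_smul, TensorProduct.smul_tmul', ← Algebra.commutes,
          ← Algebra.smul_def, map_smul]
        rfl⟩
  refine ⟨τ, fun a b => ?_⟩
  rw [hτ, algebraMap_character_apply, ← Algebra.commutes, ← Algebra.smul_def]

/-- The mirror image, with `L` embedded in `ℂ ⊗ L`. It serves to make the leg `C(𝕋)` trivial in the
construction of `ψ`. -/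
theorem exists_slice_left (hD : HasNormingReps D) (χ : A →⋆ₐ[ℂ] ℂ) (f : B →⋆ₐ[ℂ] D) :
    ∃ τ : MinTensor A B →⋆ₐ[ℂ] D, ∀ a b, τ (tmul a b) = χ a • f b := by
  obtain ⟨τ, hτ⟩ := exists_product hD ((StarAlgHom.ofId ℂ D).comp χ) f
    (fun a b => Algebra.commute_algebraMap_left (χ a) (f b)) fun L _ _ _ ω =>
      ⟨ℂ, L, _, _, inferInstance, _, _, inferInstance, (StarAlgHom.ofId ℂ (ℂ →L[ℂ] ℂ)).comp χ,
        ω.comp f, (TensorProduct.lidIsometry ℂ L).symm.toLinearIsometry, fun a b v => by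
        rw [spatialRep_tmul]
        change (χ a • (1 : ℂ)) ⊗ₜ[ℂ] ω (f b) v = (1 : ℂ) ⊗ₜ[ℂ] ω (algebraMap ℂ D (χ a) * f b) v
        rw [TensorProduct.smul_tmul, ← Algebra.smul_def, map_smul]
        rfl⟩
  refine ⟨τ, fun a b => ?_⟩
  rw [hτ, algebraMap_character_apply, ← Algebra.smul_def]

end MinTensor

/-! ### The norm of the tensor product with the circle -/

/-- If `∑ h_k² = 1`, then a combination `∑ h_k b_k h_k` of contractions is a contraction. -/
theorem norm_sum_mul_mul_le {L ι : Type} [NormedAddCommGroup L] [InnerProductSpace ℂ L]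
    [CompleteSpace L] [Fintype ι] (h b : ι → L →L[ℂ] L) (hs : ∀ k, star (h k) = h k)
    (h1 : ∑ k, h k * h k = 1) {C : ℝ} (hC : 0 ≤ C) (hb : ∀ k, ‖b k‖ ≤ C) :
    ‖∑ k, h k * b k * h k‖ ≤ C := by
  -- The column of the `h k` is an isometry, and the sum is the diagonal operator of the `b k`
  -- compressed by it. The estimate below is the Cauchy–Schwarz inequality for this compression.
  have hsq (v : L) : ∑ k, ‖h k v‖ ^ 2 = ‖v‖ ^ 2 := by
    have (k : ι) : ‖h k v‖ ^ 2 = RCLike.re (inner ℂ ((h k * h k) v) v) := by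
      rw [← inner_self_eq_norm_sq (𝕜 := ℂ), mul_apply_eq_comp]
      nth_rw 3 [← hs k]
      rw [ContinuousLinearMap.star_eq_adjoint, ContinuousLinearMap.adjoint_inner_left]
    simp only [this]
    rw [← map_sum, ← sum_inner, ← sum_apply, h1, one_apply_eq_self,
      inner_self_eq_norm_sq]
  refine ContinuousLinearMap.opNorm_le_bound _ hC fun v => ?_
  set w := (∑ k, h k * b k * h k) v with hw
  have h2 : ‖w‖ ^ 2 ≤ C * (‖v‖ * ‖w‖) := by
    calc ‖w‖ ^ 2 = RCLike.re (inner ℂ w w) := (inner_self_eq_norm_sq w).symm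
      _ = ∑ k, RCLike.re (inner ℂ (b k (h k v)) (h k w)) := by
          nth_rw 1 [hw]
          rw [sum_apply, sum_inner, map_sum]
          refine Finset.sum_congr rfl fun k _ => ?_
          rw [mul_apply_eq_comp, mul_apply_eq_comp]
          nth_rw 1 [← hs k]
          rw [ContinuousLinearMap.star_eq_adjoint, ContinuousLinearMap.adjoint_inner_left]
      _ ≤ ∑ k, C * (‖h k v‖ * ‖h k w‖) := by
          refine Finset.sum_le_sum fun k _ => (re_inner_le_norm _ _).trans ?_
          rw [← mul_assoc]
          exact mul_le_mul_of_nonneg_right (((b k).le_opNorm _).trans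
            (mul_le_mul_of_nonneg_right (hb k) (norm_nonneg _))) (norm_nonneg _)
      _ ≤ C * (‖v‖ * ‖w‖) := by
          rw [← Finset.mul_sum]
          refine mul_le_mul_of_nonneg_left ?_ hC
          refine (Real.sum_mul_le_sqrt_mul_sqrt _ _ _).trans ?_
          rw [hsq, hsq, Real.sqrt_sq (norm_nonneg _), Real.sqrt_sq (norm_nonneg _)]
  rcases (norm_nonneg w).eq_or_lt with h0 | h0
  · rw [← h0]; positivity
  · nlinarith

/-- Evaluation at a point of the circle. -/
def CircleAlg.ev (w : Circle) : CircleAlg →⋆ₐ[ℂ] ℂ := ContinuousMap.evalStarAlgHom ℂ ℂ w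

theorem CircleAlg.ev_apply (w : Circle) (f : CircleAlg) : CircleAlg.ev w f = f w := rfl

/-- By compactness, finitely many open sets cover the circle on which each `f ∈ S` stays within `ε`
of its value at a base point; a subordinate partition of unity does the rest. The weights are
squares so that one factor can be placed on each side of an operator. -/
theorem CircleAlg.exists_partition (S : Finset CircleAlg) {ε : ℝ} (hε : 0 < ε) :
    ∃ (N : ℕ) (w : Fin N → Circle) (h : Fin N → CircleAlg), (∀ k, star (h k) = h k) ∧
      ∑ k, h k * h k = 1 ∧ ∀ f ∈ S, ‖f - ∑ k, f (w k) • (h k * h k)‖ ≤ ε := by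
  let O (w₀ : Circle) : Set Circle := ⋂ f ∈ S, {w | ‖f w - f w₀‖ < ε}
  have hO (w₀) : IsOpen (O w₀) := isOpen_biInter_finset fun f _ =>
    isOpen_lt (by fun_prop) continuous_const
  obtain ⟨t, ht⟩ := isCompact_univ.elim_finite_subcover O hO fun w _ =>
    Set.mem_iUnion.2 ⟨w, Set.mem_iInter₂.2 fun f _ => by simpa using hε⟩
  let w : Fin t.card → Circle := fun k => t.equivFin.symm k
  obtain ⟨g, hg1, hg2, hg3, -⟩ := exists_continuous_sum_one_of_isOpen_isCompact
    (s := fun k => O (w k)) (fun k => hO _) isCompact_univ (fun x hx => by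
      obtain ⟨y, hy, hxy⟩ := Set.mem_iUnion₂.1 (ht hx)
      exact Set.mem_iUnion.2 ⟨t.equivFin ⟨y, hy⟩, by simpa [w] using hxy⟩)
  let h : Fin t.card → CircleAlg := fun k => ⟨fun x => ((√(g k x) : ℝ) : ℂ), by fun_prop⟩
  have hh (k x) : (h k * h k) x = (g k x : ℂ) := by
    change ((√(g k x) : ℝ) : ℂ) * ((√(g k x) : ℝ) : ℂ) = _
    rw [← Complex.ofReal_mul, Real.mul_self_sqrt (hg3 k x).1]
  have hsum (x) : ∑ k, g k x = 1 := by
    simpa using hg2 (Set.mem_univ x)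
  refine ⟨t.card, w, h, fun k => ?_, ?_, fun f hf => ?_⟩
  · ext x
    exact Complex.conj_ofReal _
  · ext x
    rw [ContinuousMap.sum_apply]
    simp only [hh]
    rw [← Complex.ofReal_sum, hsum x, Complex.ofReal_one]; rfl
  · refine (ContinuousMap.norm_le _ hε.le).2 fun x => ?_
    have : (f - ∑ k, f (w k) • (h k * h k)) x = ∑ k, (f x - f (w k)) * (g k x : ℂ) := by
      simp only [ContinuousMap.sub_apply, ContinuousMap.sum_apply, ContinuousMap.smul_apply, hh,
        sub_mul, Finset.sum_sub_distrib, ← Finset.mul_sum, smul_eq_mul]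
      rw [← Complex.ofReal_sum, hsum, Complex.ofReal_one, mul_one]
    rw [this]
    calc _ ≤ ∑ k, ε * g k x := (norm_sum_le _ _).trans (Finset.sum_le_sum fun k _ => by
            rw [norm_mul, Complex.norm_real, Real.norm_of_nonneg (hg3 k x).1]
            by_cases hx : g k x = 0
            · rw [hx]; simp
            · refine mul_le_mul_of_nonneg_right ?_ (hg3 k x).1
              exact (Set.mem_iInter₂.1 (hg1 k (subset_tsupport _ hx)) f hf).le)
      _ = ε := by rw [← Finset.mul_sum, hsum, mul_one]

namespace MinTensor

variable {Y : Type} [CStarAlgebra Y]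

open Classical in
-- Regard `t` as a function on the circle and sample it at the points of a fine partition of unity
-- `g_k²`. The sampled element is `∑ (1 ⊗ g_k)(t(w_k) ⊗ 1)(1 ⊗ g_k)`, which `norm_sum_mul_mul_le`
-- bounds by `C`, and it is as close to `t` as desired.
theorem norm_ofAlg_le_of_slice (t : Y ⊗[ℂ] CircleAlg) (s : Circle → MinTensor Y CircleAlg →⋆ₐ[ℂ] Y)
    (hs : ∀ w a f, s w (tmul a f) = f w • a) {C : ℝ}
    (h : ∀ w, ‖s w (ofAlg _ _ t)‖ ≤ C) : ‖ofAlg _ _ t‖ ≤ C := by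
  obtain ⟨S, hS⟩ := TensorProduct.exists_finset t
  have hC : 0 ≤ C := (norm_nonneg _).trans (h 1)
  let M : ℝ := ∑ i ∈ S, ‖i.1‖
  have hM : 0 ≤ M := Finset.sum_nonneg fun _ _ => norm_nonneg _
  refine le_of_forall_pos_le_add fun ε hε => ?_
  -- The sampling error is at most `M` times the tolerance; the summand `1` covers the case `M = 0`.
  have hε' : 0 < ε / (M + 1) := by positivity
  obtain ⟨N, w, g, hg1, hg2, hg3⟩ := CircleAlg.exists_partition (S.image Prod.snd) hε'
  let T : MinTensor Y CircleAlg := ∑ k, tmul (s (w k) (ofAlg _ _ t)) (g k * g k)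
  have hT : ‖T‖ ≤ C := by
    refine hasNormingReps _ _ _ _ fun L _ _ _ ω => ?_
    have h1 : ω T = ∑ k, ω (tmul 1 (g k)) * ω (tmul (s (w k) (ofAlg _ _ t)) 1) *
        ω (tmul 1 (g k)) := by
      rw [map_sum]
      refine Finset.sum_congr rfl fun k _ => ?_
      rw [← map_mul, ← map_mul, tmul_mul, tmul_mul, one_mul, mul_one, mul_one]
    rw [h1]
    refine norm_sum_mul_mul_le _ _ (fun k => ?_) ?_ hC fun k => ?_
    · rw [← map_star, star_tmul, star_one, hg1]
    · simp only [← map_mul, tmul_mul, ← map_sum, mul_one]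
      rw [← map_one ω]
      simp only [← inr_apply, ← map_sum, hg2, map_one]
    · exact (norm_starAlgHom_le ω _).trans
        (((norm_starAlgHom_le (inl Y CircleAlg) _)).trans (h _))
  have ht : ofAlg _ _ t = ∑ i ∈ S, tmul i.1 i.2 := by
    rw [hS, map_sum]; rfl
  have hd : ofAlg _ _ t - T = ∑ i ∈ S, tmul i.1 (i.2 - ∑ k, i.2 (w k) • (g k * g k)) := by
    have : T = ∑ i ∈ S, ∑ k, tmul i.1 (i.2 (w k) • (g k * g k)) := by
      rw [Finset.sum_comm]
      refine Finset.sum_congr rfl fun k _ => ?_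
      rw [ht, map_sum, sum_tmul]
      refine Finset.sum_congr rfl fun i _ => ?_
      rw [hs]
      exact congrArg (ofAlg Y CircleAlg) (TensorProduct.smul_tmul _ _ _)
    rw [this, ht, ← Finset.sum_sub_distrib]
    refine Finset.sum_congr rfl fun i _ => ?_
    simp only [tmul_eq i.1, map_sub, map_sum, mul_sub, Finset.mul_sum]
  have h5 : ‖ofAlg _ _ t - T‖ ≤ ε := by
    rw [hd]
    calc _ ≤ ∑ i ∈ S, ‖i.1‖ * (ε / (M + 1)) :=
          (norm_sum_le _ _).trans (Finset.sum_le_sum fun i hi => (norm_tmul_le _ _).trans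
            (mul_le_mul_of_nonneg_left (hg3 _ (Finset.mem_image_of_mem _ hi)) (norm_nonneg _)))
      _ = M * (ε / (M + 1)) := (Finset.sum_mul _ _ _).symm
      _ ≤ ε := by
          rw [mul_div_assoc', div_le_iff₀ (by positivity)]
          nlinarith
  have h6 := norm_add_le (ofAlg _ _ t - T) T
  rw [sub_add_cancel] at h6
  linarith

/-- The norm of `Y ⊗ C(𝕋)` is the supremum of the norms of the slices. -/
theorem norm_le_of_slice (d : MinTensor Y CircleAlg) (s : Circle → MinTensor Y CircleAlg →⋆ₐ[ℂ] Y)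
    (hs : ∀ w a f, s w (tmul a f) = f w • a) {C : ℝ} (h : ∀ w, ‖s w d‖ ≤ C) : ‖d‖ ≤ C := by
  refine le_of_forall_pos_le_add fun ε hε => ?_
  obtain ⟨t, ht⟩ := exists_approx d (half_pos hε)
  have h1 : ‖ofAlg _ _ t‖ ≤ C + ε / 2 := by
    refine norm_ofAlg_le_of_slice t s hs fun w => ?_
    have h3 := (norm_starAlgHom_le (s w) (d - ofAlg _ _ t)).trans ht.le
    rw [map_sub, norm_sub_rev] at h3
    linarith [h w, norm_sub_norm_le (s w (ofAlg _ _ t)) (s w d)]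
  linarith [norm_sub_norm_le d (ofAlg _ _ t)]

end MinTensor

/-! ### A representation of the noncommutative torus -/

theorem FreeStar.map_eval {G D D' : Type} [Ring D] [StarRing D] [Algebra ℂ D] [StarModule ℂ D]
    [Ring D'] [StarRing D'] [Algebra ℂ D'] [StarModule ℂ D'] (φ : D →⋆ₐ[ℂ] D') (f : G → D)
    (p : FreeStar G) : φ (FreeStar.eval f p) = FreeStar.eval (fun g => φ (f g)) p := by
  induction p using FreeStar.induct_gen with
  | halg c => rw [AlgHomClass.commutes, AlgHomClass.commutes, AlgHomClass.commutes]
  | hgen g => rw [FreeStar.eval_gen, FreeStar.eval_gen]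
  | hstar g => rw [map_star, map_star, map_star, FreeStar.eval_gen, FreeStar.eval_gen]
  | hadd x y hx hy => rw [map_add, map_add, map_add, hx, hy]
  | hmul x y hx hy => rw [map_mul, map_mul, map_mul, hx, hy]

namespace CircleAlg

theorem zpow_mul_zpow_neg (k : ℤ) : zpow k * zpow (-k) = 1 := by
  rw [zpow_mul, add_neg_cancel, zpow_zero]

theorem zpow_mem_unitary (k : ℤ) : zpow k ∈ unitary CircleAlg := by
  rw [Unitary.mem_iff, star_zpow, zpow_mul, zpow_mul, neg_add_cancel, add_neg_cancel, zpow_zero]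
  exact ⟨rfl, rfl⟩

theorem map_zpow_apply_of_map_z {H : Type} [NormedAddCommGroup H] [InnerProductSpace ℂ H]
    [CompleteSpace H] (g : CircleAlg →⋆ₐ[ℂ] (H →L[ℂ] H)) (x : ℤ → H)
    (hx : ∀ k, g z (x k) = x (k + 1)) (m k : ℤ) : g (zpow m) (x k) = x (k + m) := by
  induction m generalizing k with
  | zero => rw [zpow_zero, map_one, add_zero]; rfl
  | succ m ih =>
    rw [add_comm (m : ℤ) 1, ← zpow_mul, map_mul, mul_apply_eq_comp, ih, ← z, hx]
    congr 1; ring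
  | pred m ih =>
    have h1 : x k = g z (x (k - 1)) := by rw [hx, sub_add_cancel]
    rw [h1, z, ← mul_apply_eq_comp, ← map_mul, zpow_mul, sub_add_cancel, ih]
    congr 1; ring

end CircleAlg

namespace TorusAlg

variable (ζ : Circle)

theorem ι₁_z : ι₁ ζ CircleAlg.z = (torusPresentation ζ).gen false :=
  CircleAlg.lift_z (U ζ) (gen_mem_unitary ζ false)

theorem ι₂_z : ι₂ ζ CircleAlg.z = (torusPresentation ζ).gen true :=
  CircleAlg.lift_z (V ζ) (gen_mem_unitary ζ true)

/-- The universal property of the noncommutative torus. -/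
def lift {D : Type} [CStarAlgebra D] (u v : D) (hu : u ∈ unitary D) (hv : v ∈ unitary D)
    (h : v * u = (ζ : ℂ) • (u * v)) : TorusAlg ζ →⋆ₐ[ℂ] D :=
  (torusPresentation ζ).lift (fun g => if g then v else u) (by
    rintro r (⟨g, rfl | rfl⟩ | rfl)
    · rw [map_sub, map_mul, map_star, map_one, FreeStar.eval_gen]
      cases g
      · simp [hu.1]
      · simp [hv.1]
    · rw [map_sub, map_mul, map_star, map_one, FreeStar.eval_gen]
      cases g
      · simp [hu.2]
      · simp [hv.2]
    · rw [map_sub, map_smul, map_mul, map_mul, FreeStar.eval_gen, FreeStar.eval_gen]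
      simp [h])

variable {ζ} in
theorem lift_ι₁_z {D : Type} [CStarAlgebra D] {u v : D} (hu : u ∈ unitary D) (hv : v ∈ unitary D)
    (h : v * u = (ζ : ℂ) • (u * v)) : lift ζ u v hu hv h (ι₁ ζ CircleAlg.z) = u := by
  rw [ι₁_z]
  exact (torusPresentation ζ).lift_gen _ _ _

variable {ζ} in
theorem lift_ι₂_z {D : Type} [CStarAlgebra D] {u v : D} (hu : u ∈ unitary D) (hv : v ∈ unitary D)
    (h : v * u = (ζ : ℂ) • (u * v)) : lift ζ u v hu hv h (ι₂ ζ CircleAlg.z) = v := by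
  rw [ι₂_z]
  exact (torusPresentation ζ).lift_gen _ _ _

theorem ι₂_z_mul_ι₁_z : ι₂ ζ CircleAlg.z * ι₁ ζ CircleAlg.z =
    (ζ : ℂ) • (ι₁ ζ CircleAlg.z * ι₂ ζ CircleAlg.z) := by
  have := (torusPresentation ζ).toAlg_rel (Or.inr rfl)
  rw [map_sub, map_smul, map_mul, map_mul, sub_eq_zero] at this
  rw [ι₁_z, ι₂_z]
  exact this

theorem exists_unitary_of_hilbertBasis {H : Type} [NormedAddCommGroup H] [InnerProductSpace ℂ H]
    [CompleteSpace H] (b v : HilbertBasis ℤ ℂ H) :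
    ∃ T ∈ unitary (H →L[ℂ] H), ∀ s, T (b s) = v s := by
  refine ⟨_, (Unitary.linearIsometryEquiv.symm (b.repr.trans v.repr.symm)).2, fun s => ?_⟩
  rw [Unitary.coe_symm_linearIsometryEquiv_apply]
  change v.repr.symm (b.repr (b s)) = v s
  rw [b.repr_self, v.repr_symm_single]

/-- The representation on `ℓ²(ℤ)` by the shift and the diagonal unitary. -/
theorem exists_rep : ∃ (H : Type) (_ : NormedAddCommGroup H) (_ : InnerProductSpace ℂ H)
    (_ : CompleteSpace H) (r : TorusAlg ζ →⋆ₐ[ℂ] (H →L[ℂ] H)) (e : ℤ → H), Orthonormal ℂ e ∧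
      (∀ k s, r (ι₁ ζ (CircleAlg.zpow k)) (e s) = e (s - k)) ∧
      ∀ k s, r (ι₂ ζ (CircleAlg.zpow k)) (e s) = ((ζ ^ (-(s * k)) : Circle) : ℂ) • e s := by
  let H := lp (fun _ : ℤ => ℂ) 2
  let b : HilbertBasis ℤ ℂ H := HilbertBasis.ofRepr (LinearIsometryEquiv.refl ℂ _)
  have hb := b.orthonormal
  -- Both operators are changes of orthonormal basis, hence unitary at once: `u e_s = e_{s-1}` and
  -- `v e_s = ζ^{-s} e_s`. These signs give `v u = ζ u v`.
  let b₁ : HilbertBasis ℤ ℂ H := HilbertBasis.mk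
    (hb.comp (fun s : ℤ => s - 1) (sub_left_injective)) (by
      have : Set.range (b ∘ fun s : ℤ => s - 1) = Set.range b :=
        (Equiv.subRight (1 : ℤ)).surjective.range_comp b
      rw [this, b.dense_span])
  have hv : Orthonormal ℂ fun s : ℤ => ((ζ ^ (-s) : Circle) : ℂ) • b s := by
    refine ⟨fun s => by rw [norm_smul, Circle.norm_coe, hb.1, one_mul], fun s t hst => ?_⟩
    simp only
    rw [inner_smul_left, inner_smul_right, hb.2 hst, mul_zero, mul_zero]
  let b₂ : HilbertBasis ℤ ℂ H := HilbertBasis.mk hv (by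
    rw [← b.dense_span]
    refine Submodule.topologicalClosure_mono (Submodule.span_le.2 ?_)
    rintro _ ⟨s, rfl⟩
    have : b s = ((ζ ^ s : Circle) : ℂ) • ((ζ ^ (-s) : Circle) : ℂ) • b s := by
      rw [smul_smul, ← Circle.coe_mul, ← zpow_add, add_neg_cancel, zpow_zero, Circle.coe_one,
        one_smul]
    rw [this]
    exact Submodule.smul_mem _ _ (Submodule.subset_span ⟨s, rfl⟩))
  obtain ⟨u, hu, hu'⟩ := exists_unitary_of_hilbertBasis b b₁
  obtain ⟨v, hv, hv'⟩ := exists_unitary_of_hilbertBasis b b₂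
  have hu1 (s) : u (b s) = b (s - 1) := by
    rw [hu']; exact congrFun (HilbertBasis.coe_mk _ _) s
  have hv1 (s) : v (b s) = ((ζ ^ (-s) : Circle) : ℂ) • b s := by
    rw [hv']; exact congrFun (HilbertBasis.coe_mk _ _) s
  have hvu : v * u = (ζ : ℂ) • (u * v) := by
    refine ContinuousLinearMap.ext_on (s := Set.range b)
      (Submodule.dense_iff_topologicalClosure_eq_top.2 b.dense_span) ?_
    rintro _ ⟨s, rfl⟩
    rw [smul_apply, mul_apply_eq_comp, mul_apply_eq_comp, hu1, hv1, hv1, map_smul, hu1, smul_smul,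
      ← Circle.coe_mul, ← zpow_one_add]
    congr 3; ring
  refine ⟨H, _, _, inferInstance, lift ζ u v hu hv hvu, b, hb, fun k s => ?_, fun k s => ?_⟩
  · have := CircleAlg.map_zpow_apply_of_map_z ((lift ζ u v hu hv hvu).comp (ι₁ ζ))
      (fun k => b (s - k)) (fun k => by
        rw [StarAlgHom.comp_apply, lift_ι₁_z, hu1]
        congr 1; ring) k 0
    simpa using this
  · have := CircleAlg.map_zpow_apply_of_map_z ((lift ζ u v hu hv hvu).comp (ι₂ ζ))
      (fun k => ((ζ ^ (-(s * k)) : Circle) : ℂ) • b s) (fun k => by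
        rw [StarAlgHom.comp_apply, lift_ι₂_z, map_smul, hv1, smul_smul, ← Circle.coe_mul,
          ← zpow_add]
        congr 3; ring) k 0
    simpa using this

end TorusAlg

/-! ### *-Homomorphisms out of braided tensor products -/

namespace Circle

theorem coe_zpow_mul_coe_zpow (ζ : Circle) (k l : ℤ) :
    ((ζ ^ k : Circle) : ℂ) * ((ζ ^ l : Circle) : ℂ) = ((ζ ^ (k + l) : Circle) : ℂ) := by
  rw [← Circle.coe_mul, ← zpow_add]

theorem coe_zpow_zero (ζ : Circle) : ((ζ ^ (0 : ℤ) : Circle) : ℂ) = 1 := by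
  rw [zpow_zero, Circle.coe_one]

theorem star_coe_zpow (ζ : Circle) (k : ℤ) :
    star ((ζ ^ k : Circle) : ℂ) = ((ζ ^ (-k) : Circle) : ℂ) := by
  rw [zpow_neg, Circle.coe_inv_eq_conj]
  rfl

end Circle

/-- The sum telescopes to at most `2|k|` boundary terms. That the bound does not depend on `N` is
the Følner property of intervals in `ℤ`. -/
theorem norm_sum_sub_shift_le {E : Type} [SeminormedAddCommGroup E] (g : ℤ → E) {M : ℝ}
    (hg : ∀ s, ‖g s‖ ≤ M) (k : ℤ) (N : ℕ) :
    ‖∑ s ∈ Finset.range N, (g s - g (s + k))‖ ≤ 2 * |(k : ℝ)| * M := by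
  have key (g : ℤ → E) (hg : ∀ s, ‖g s‖ ≤ M) (k : ℕ) :
      ‖∑ s ∈ Finset.range N, (g s - g (s + k))‖ ≤ 2 * k * M := by
    induction k with
    | zero => simp
    | succ k ih =>
      have h1 : ∑ s ∈ Finset.range N, (g (s + k) - g (s + (k + 1 : ℕ))) = g k - g (N + k) := by
        have := Finset.sum_range_sub' (fun s : ℕ => g (s + k)) N
        rw [Nat.cast_zero, zero_add] at this
        rw [← this]
        refine Finset.sum_congr rfl fun s _ => ?_
        congr 2; push_cast; ring
      have h2 : ∑ s ∈ Finset.range N, (g s - g (s + (k + 1 : ℕ))) =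
          ∑ s ∈ Finset.range N, (g s - g (s + k)) + (g k - g (N + k)) := by
        rw [← h1, ← Finset.sum_add_distrib]
        exact Finset.sum_congr rfl fun s _ => by abel
      rw [h2]
      have h3 := norm_add_le (∑ s ∈ Finset.range N, (g s - g (s + k))) (g k - g (N + k))
      have h4 := norm_sub_le (g k) (g (N + k))
      have := hg k
      have := hg (N + k)
      push_cast
      linarith
  rcases le_total 0 k with hk | hk
  · lift k to ℕ using hk
    simpa using key g hg k
  · obtain ⟨m, rfl⟩ : ∃ m : ℕ, k = -m := ⟨k.natAbs, by omega⟩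
    have := key (fun s => g (s - m)) (fun s => hg _) m
    simp only [add_sub_cancel_right] at this
    rw [← norm_neg, ← Finset.sum_neg_distrib]
    simpa [← sub_eq_add_neg] using this

namespace Braided

/-! ### Approximate intertwiners and the norm inequality they give -/

section Asymptotic

variable {L H : Type} [NormedAddCommGroup L] [InnerProductSpace ℂ L] [CompleteSpace L]
  [NormedAddCommGroup H] [InnerProductSpace ℂ H]
  (h : CircleAlg →⋆ₐ[ℂ] (L →L[ℂ] L)) (e : ℤ → H)

open MinTensor CircleAlg

/-- The vector `∑ s < N, h (z ^ s) v ⊗ e_s`. -/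
def spread (N : ℕ) : L →ₗ[ℂ] Hilbert (L ⊗[ℂ] H) :=
  ∑ s ∈ Finset.range N, (toHilbert (L ⊗[ℂ] H)).toLinearMap ∘ₗ
    (TensorProduct.mk ℂ L H).flip (e s) ∘ₗ (h (zpow s)).toLinearMap

theorem spread_apply (N : ℕ) (v : L) :
    spread h e N v = ∑ s ∈ Finset.range N, toHilbert (L ⊗[ℂ] H) (h (zpow s) v ⊗ₜ e s) := by
  rw [spread, LinearMap.sum_apply]
  rfl

variable {e} in
-- The `N` summands are mutually orthogonal because the `e_s` are, and each has norm `‖v‖` because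
-- `h(z^s)` is unitary.
theorem norm_spread (he : Orthonormal ℂ e) (N : ℕ) (v : L) : ‖spread h e N v‖ = √N * ‖v‖ := by
  have hu (s : ℤ) : inner ℂ (h (zpow s) v) (h (zpow s) v) = inner ℂ v v := by
    rw [← ContinuousLinearMap.adjoint_inner_left, ← ContinuousLinearMap.star_eq_adjoint, ← map_star,
      ← mul_apply_eq_comp, ← map_mul, (zpow_mem_unitary s).1, map_one]
    rfl
  have h1 : inner ℂ (spread h e N v) (spread h e N v) = N * inner ℂ v v := by
    rw [spread_apply, sum_inner]
    simp only [inner_sum, LinearIsometry.inner_map_map, TensorProduct.inner_tmul,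
      orthonormal_iff_ite.1 he, Nat.cast_inj, mul_ite, mul_one, mul_zero]
    rw [Finset.sum_congr rfl fun s hs => (Finset.sum_ite_eq _ s _).trans (if_pos hs)]
    simp only [hu, Finset.sum_const, Finset.card_range, nsmul_eq_mul]
  rw [inner_self_eq_norm_sq_to_K, inner_self_eq_norm_sq_to_K] at h1
  have h2 : ‖spread h e N v‖ ^ 2 = (√N * ‖v‖) ^ 2 := by
    rw [mul_pow, Real.sq_sqrt (Nat.cast_nonneg N)]
    rw [← Complex.ofReal_inj]
    push_cast
    exact h1
  exact (pow_left_inj₀ (norm_nonneg _) (by positivity) two_ne_zero).1 h2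

/-- The operators `a` and `b` are intertwined by `spread`, up to a bounded error. -/
def Near (a : Hilbert (L ⊗[ℂ] H) →L[ℂ] Hilbert (L ⊗[ℂ] H)) (b : L →L[ℂ] L) : Prop :=
  ∃ C : ℝ, ∀ N v, ‖a (spread h e N v) - spread h e N (b v)‖ ≤ C * ‖v‖

variable {h e}

theorem Near.add {a a' : Hilbert (L ⊗[ℂ] H) →L[ℂ] Hilbert (L ⊗[ℂ] H)} {b b' : L →L[ℂ] L}
    (hab : Near h e a b) (hab' : Near h e a' b') : Near h e (a + a') (b + b') := by
  obtain ⟨C, hC⟩ := hab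
  obtain ⟨C', hC'⟩ := hab'
  refine ⟨C + C', fun N v => ?_⟩
  rw [add_apply, add_apply, map_add, add_sub_add_comm, add_mul]
  exact (norm_add_le _ _).trans (add_le_add (hC N v) (hC' N v))

/-- The error made by `a'` is enlarged at most by the factor `‖a‖`, and the error made by `a` is
evaluated at `b' v`; neither depends on `N`. Together with sums and scalars, this reduces
*-polynomials to the generators and their adjoints. -/
theorem Near.mul {a a' : Hilbert (L ⊗[ℂ] H) →L[ℂ] Hilbert (L ⊗[ℂ] H)} {b b' : L →L[ℂ] L}
    (hab : Near h e a b) (hab' : Near h e a' b') : Near h e (a * a') (b * b') := by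
  obtain ⟨C, hC⟩ := hab
  obtain ⟨C', hC'⟩ := hab'
  refine ⟨‖a‖ * C' + |C| * ‖b'‖, fun N v => ?_⟩
  rw [mul_apply_eq_comp, mul_apply_eq_comp]
  have h1 : a (a' (spread h e N v)) - spread h e N (b (b' v)) =
      a (a' (spread h e N v) - spread h e N (b' v)) +
        (a (spread h e N (b' v)) - spread h e N (b (b' v))) := by
    rw [map_sub]; abel
  rw [h1]
  have h2 : ‖a (a' (spread h e N v) - spread h e N (b' v))‖ ≤ ‖a‖ * (C' * ‖v‖) :=
    (a.le_opNorm _).trans (mul_le_mul_of_nonneg_left (hC' N v) (norm_nonneg _))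
  have h3 : ‖a (spread h e N (b' v)) - spread h e N (b (b' v))‖ ≤ |C| * (‖b'‖ * ‖v‖) :=
    (hC N (b' v)).trans (mul_le_mul (le_abs_self C) (b'.le_opNorm v) (norm_nonneg _) (abs_nonneg C))
  have := norm_add_le (a (a' (spread h e N v) - spread h e N (b' v)))
    (a (spread h e N (b' v)) - spread h e N (b (b' v)))
  linarith

theorem near_algebraMap (c : ℂ) : Near h e (algebraMap ℂ _ c) (algebraMap ℂ _ c) :=
  ⟨0, fun N v => by
    rw [ContinuousLinearMap.algebraMap_apply, ContinuousLinearMap.algebraMap_apply, map_smul,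
      sub_self, norm_zero, zero_mul]⟩

/-- A bounded error is negligible against the growth `√N ‖v‖` of the test vectors: `√N (‖b v‖ - ‖a‖
‖v‖)` stays bounded in `N`, so the bracket cannot be positive. -/
theorem Near.norm_le (he : Orthonormal ℂ e)
    {a : Hilbert (L ⊗[ℂ] H) →L[ℂ] Hilbert (L ⊗[ℂ] H)} {b : L →L[ℂ] L} (hab : Near h e a b) :
    ‖b‖ ≤ ‖a‖ := by
  obtain ⟨C, hC⟩ := hab
  refine ContinuousLinearMap.opNorm_le_bound _ (norm_nonneg _) fun v => ?_
  have key (N : ℕ) : √N * (‖b v‖ - ‖a‖ * ‖v‖) ≤ C * ‖v‖ := by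
    have h1 := hC N v
    have h2 := a.le_opNorm (spread h e N v)
    have h3 := norm_sub_norm_le (spread h e N (b v)) (a (spread h e N v))
    rw [norm_sub_rev] at h3
    rw [norm_spread h he] at h2 h3
    nlinarith
  by_contra! hlt
  obtain ⟨N, hN⟩ := exists_nat_gt ((C * ‖v‖ / (‖b v‖ - ‖a‖ * ‖v‖)) ^ 2)
  have h1 := (Real.lt_sqrt_of_sq_lt hN)
  rw [div_lt_iff₀ (sub_pos.2 hlt)] at h1
  exact absurd (key N) (not_le.2 h1)

variable [CompleteSpace H] {X Y : Type} [CStarAlgebra X] [CStarAlgebra Y] {ζ : Circle}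
  {τ : MinTensor X Y →⋆ₐ[ℂ] (L →L[ℂ] L)} {r : TorusAlg ζ →⋆ₐ[ℂ] (H →L[ℂ] H)}

/-- The shift `U^k` moves the index `s` by `k`. On the test vectors this amounts to replacing `v` by
`h(z^k) v`, except for `|k|` terms at each end of the interval; this is where the error arises. -/
theorem near_left (he : Orthonormal ℂ e)
    (hr : ∀ k s, r (TorusAlg.ι₁ ζ (zpow k)) (e s) = e (s - k)) {x : X}
    (hx : ∀ m, Commute (τ (tmul x 1)) (h (zpow m))) (k : ℤ) :
    Near h e (spatialHat τ r (tmul (tmul x 1) (TorusAlg.ι₁ ζ (zpow k))))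
      (τ (tmul x 1) * h (zpow k)) := by
  refine ⟨2 * |(k : ℝ)| * ‖τ (tmul x 1)‖, fun N v => ?_⟩
  let g (s : ℤ) := toHilbert (L ⊗[ℂ] H) (τ (tmul x 1) (h (zpow s) v) ⊗ₜ e (s - k))
  have hu (s : ℤ) : ‖h (zpow s)‖ ≤ 1 := (norm_starAlgHom_le h _).trans
    (CStarRing.norm_of_mem_unitary (zpow_mem_unitary s)).le
  have hg (s : ℤ) : ‖g s‖ ≤ ‖τ (tmul x 1)‖ * ‖v‖ := by
    rw [LinearIsometry.norm_map, TensorProduct.norm_tmul, he.1, mul_one]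
    refine (ContinuousLinearMap.le_opNorm _ _).trans
      (mul_le_mul_of_nonneg_left ?_ (norm_nonneg _))
    exact (ContinuousLinearMap.le_of_opNorm_le _ (hu s) v).trans (one_mul _).le
  have := norm_sum_sub_shift_le g hg k N
  rw [← mul_assoc] at this
  refine le_trans (le_of_eq ?_) this
  rw [spread_apply, spread_apply, map_sum, ← Finset.sum_sub_distrib]
  congr 1
  refine Finset.sum_congr rfl fun s _ => ?_
  rw [spatialHat_tmul, hr, mul_apply_eq_comp]
  congr 2
  rw [add_sub_cancel_right, ← mul_apply_eq_comp, ← (hx _).eq, mul_apply_eq_comp, ← zpow_mul, map_mul,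
    mul_apply_eq_comp]

/-- Moving `τ(1 ⊗ y)` past `h(z^s)` costs `ζ^{ls}`, and `V^l` contributes `ζ^{-sl}` on `e_s`. The
phases cancel, so the intertwining is exact. -/
theorem near_right
    (hr : ∀ k s, r (TorusAlg.ι₂ ζ (zpow k)) (e s) = ((ζ ^ (-(s * k)) : Circle) : ℂ) • e s)
    {y : Y} {l : ℤ} (hy : ∀ m, τ (tmul 1 y) * h (zpow m) =
      ((ζ ^ (l * m) : Circle) : ℂ) • (h (zpow m) * τ (tmul 1 y))) :
    Near h e (spatialHat τ r (tmul (tmul 1 y) (TorusAlg.ι₂ ζ (zpow l)))) (τ (tmul 1 y)) := by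
  refine ⟨0, fun N v => ?_⟩
  rw [zero_mul, norm_le_zero_iff, sub_eq_zero, spread_apply, spread_apply, map_sum]
  refine Finset.sum_congr rfl fun s _ => ?_
  rw [spatialHat_tmul, hr, ← mul_apply_eq_comp, hy, smul_apply, TensorProduct.smul_tmul_smul,
    Circle.coe_zpow_mul_coe_zpow, mul_comm l, add_neg_cancel, Circle.coe_zpow_zero, one_smul]
  rfl

end Asymptotic

/-! ### Homomorphisms of `X ⊠ Y` from a unitary with braid relations -/

section Hom

open MinTensor CircleAlg

variable (ζ : Circle) {X Y I J : Type} [CStarAlgebra X] [CStarAlgebra Y]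
  {ρX : X →⋆ₐ[ℂ] MinTensor X CircleAlg} {ρY : Y →⋆ₐ[ℂ] MinTensor Y CircleAlg}
  {x : I → X} {k : I → ℤ} {y : J → Y} {l : J → ℤ}

theorem incl_j₁ {x : X} {k : ℤ} (hx : ρX x = tmul x (zpow k)) :
    incl ζ ρX ρY (j₁ ζ ρX ρY x) = tmul (tmul x 1) (TorusAlg.ι₁ ζ (zpow k)) := by
  change MinTensor.map (inl X Y) (TorusAlg.ι₁ ζ) (ρX x) = _
  rw [hx, map_tmul, inl_apply]

theorem incl_j₂ {y : Y} {k : ℤ} (hy : ρY y = tmul y (zpow k)) :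
    incl ζ ρX ρY (j₂ ζ ρX ρY y) = tmul (tmul 1 y) (TorusAlg.ι₂ ζ (zpow k)) := by
  change MinTensor.map (inr X Y) (TorusAlg.ι₂ ζ) (ρY y) = _
  rw [hy, map_tmul, inr_apply]

/-- The spatial representation of `τ` and of the torus representation, restricted to `X ⊠ Y`, is
`Near` the prescribed operators on every *-polynomial. `Near.norm_le` then applies, and the
restriction is contractive. -/
theorem norm_eval_le {L : Type} [NormedAddCommGroup L] [InnerProductSpace ℂ L] [CompleteSpace L]
    (hx : ∀ i, ρX (x i) = tmul (x i) (zpow (k i))) (hy : ∀ j, ρY (y j) = tmul (y j) (zpow (l j)))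
    (τ : MinTensor X Y →⋆ₐ[ℂ] (L →L[ℂ] L)) (h : CircleAlg →⋆ₐ[ℂ] (L →L[ℂ] L))
    (hτ : ∀ i m, Commute (τ (tmul (x i) 1)) (h (zpow m)))
    (hτ' : ∀ j m, τ (tmul 1 (y j)) * h (zpow m) =
      ((ζ ^ (l j * m) : Circle) : ℂ) • (h (zpow m) * τ (tmul 1 (y j))))
    (p : FreeStar (I ⊕ J)) :
    ‖FreeStar.eval (Sum.elim (fun i => τ (tmul (x i) 1) * h (zpow (k i)))
      (fun j => τ (tmul 1 (y j)))) p‖ ≤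
      ‖FreeStar.eval (Sum.elim (fun i => j₁ ζ ρX ρY (x i)) (fun j => j₂ ζ ρX ρY (y j))) p‖ := by
  obtain ⟨H, _, _, _, r, e, he, hr₁, hr₂⟩ := TorusAlg.exists_rep ζ
  let R := (spatialHat τ r).comp (incl ζ ρX ρY)
  refine le_trans (Near.norm_le (h := h) he (a := R (FreeStar.eval _ p)) ?_)
    (norm_starAlgHom_le R _)
  induction p using FreeStar.induct_gen with
  | halg c =>
    rw [AlgHomClass.commutes, AlgHomClass.commutes, AlgHomClass.commutes]
    exact near_algebraMap c
  | hadd p p' hp hp' => rw [map_add, map_add, map_add]; exact hp.add hp'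
  | hmul p p' hp hp' => rw [map_mul, map_mul, map_mul]; exact hp.mul hp'
  | hgen g =>
    rw [FreeStar.eval_gen, FreeStar.eval_gen]
    obtain i | j := g
    · change Near h e (spatialHat τ r (incl ζ ρX ρY (j₁ ζ ρX ρY (x i)))) _
      rw [incl_j₁ ζ (hx i)]
      exact near_left he hr₁ (hτ i) (k i)
    · change Near h e (spatialHat τ r (incl ζ ρX ρY (j₂ ζ ρX ρY (y j)))) _
      rw [incl_j₂ ζ (hy j)]
      exact near_right hr₂ (hτ' j)
  -- Nearness is not known to pass to adjoints, so these are treated directly: the adjoint of a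
  -- homogeneous generator is homogeneous of the opposite degree and satisfies the corresponding
  -- relations.
  | hstar g =>
    rw [map_star, map_star, map_star, FreeStar.eval_gen, FreeStar.eval_gen]
    obtain i | j := g
    · change Near h e (star (spatialHat τ r (incl ζ ρX ρY (j₁ ζ ρX ρY (x i)))))
        (star (τ (tmul (x i) 1) * h (zpow (k i))))
      have hc (m : ℤ) : Commute (τ (tmul (star (x i)) 1)) (h (zpow m)) := by
        have := (hτ i (-m)).star_star
        rwa [← map_star, ← map_star, star_tmul, star_one, star_zpow, neg_neg] at this
      rw [incl_j₁ ζ (hx i), ← map_star, star_tmul, star_tmul, ← map_star, star_zpow, star_mul,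
        ← map_star, ← map_star, star_tmul, star_zpow, star_one, ← (hc _).eq]
      exact near_left he hr₁ hc (-k i)
    · change Near h e (star (spatialHat τ r (incl ζ ρX ρY (j₂ ζ ρX ρY (y j)))))
        (star (τ (tmul 1 (y j))))
      rw [incl_j₂ ζ (hy j), ← map_star, star_tmul, star_tmul, ← map_star, star_zpow,
        ← map_star, star_tmul, star_one]
      refine near_right hr₂ fun m => ?_
      have := congrArg star (hτ' j (-m))
      rw [star_smul, star_mul, star_mul, ← map_star, ← map_star, star_tmul, star_one, star_zpow,
        neg_neg] at this
      rw [this, smul_smul, Circle.star_coe_zpow, Circle.coe_zpow_mul_coe_zpow, mul_neg, neg_neg,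
        neg_mul, neg_add_cancel, Circle.coe_zpow_zero, one_smul]

/-- A *-homomorphism of `X ⊗ Y` and a unitary that commutes with the image of `X` and braids with
that of `Y` induce a *-homomorphism of `X ⊠_ζ Y`. -/
theorem exists_hom (hgx : Generates x) (hgy : Generates y)
    (hx : ∀ i, ρX (x i) = tmul (x i) (zpow (k i))) (hy : ∀ j, ρY (y j) = tmul (y j) (zpow (l j)))
    {D : Type} [CStarAlgebra D] (hD : HasNormingReps D)
    (τ : MinTensor X Y →⋆ₐ[ℂ] D) (h : CircleAlg →⋆ₐ[ℂ] D)
    (hτ : ∀ i m, Commute (τ (tmul (x i) 1)) (h (zpow m)))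
    (hτ' : ∀ j m, τ (tmul 1 (y j)) * h (zpow m) =
      ((ζ ^ (l j * m) : Circle) : ℂ) • (h (zpow m) * τ (tmul 1 (y j)))) :
    ∃ Θ : Braided ζ ρX ρY →⋆ₐ[ℂ] D,
      (∀ i, Θ (j₁ ζ ρX ρY (x i)) = τ (tmul (x i) 1) * h (zpow (k i))) ∧
        ∀ j, Θ (j₂ ζ ρX ρY (y j)) = τ (tmul 1 (y j)) := by
  obtain ⟨Θ, hΘ⟩ := (generates ζ ρX ρY hgx hgy).exists_hom
    (Sum.elim (fun i => τ (tmul (x i) 1) * h (zpow (k i))) fun j => τ (tmul 1 (y j))) fun p => by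
      -- The relations survive composition with a representation of `D`, so the operator estimate
      -- applies in each representation separately.
      refine hD _ _ fun L _ _ _ ω => ?_
      rw [FreeStar.map_eval]
      refine le_trans (le_of_eq ?_) (norm_eval_le ζ hx hy (ω.comp τ) (ω.comp h)
        (fun i m => (hτ i m).map ω) (fun j m => ?_) p)
      · congr 3
        ext g : 1
        obtain i | j := g
        · exact map_mul ω _ _
        · rfl
      · rw [StarAlgHom.comp_apply, StarAlgHom.comp_apply, ← map_mul, hτ', map_smul, map_mul]
  exact ⟨Θ, fun i => hΘ (Sum.inl i), fun j => hΘ (Sum.inr j)⟩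

end Hom

end Braided

theorem MinTensor.tmul_smul {A B : Type} [CStarAlgebra A] [CStarAlgebra B] (c : ℂ) (a : A) (b : B) :
    MinTensor.tmul a (c • b) = c • MinTensor.tmul a b := by
  rw [tmul_eq, map_smul, mul_smul_comm, ← tmul_eq]

/-! ### Commutation relations -/

namespace CircleAlg

variable {D : Type} [CStarAlgebra D]

theorem mul_map_zpow (g : CircleAlg →⋆ₐ[ℂ] D) {b : D} {c : Circle}
    (h : b * g z = (c : ℂ) • (g z * b)) (m : ℤ) :
    b * g (zpow m) = ((c ^ m : Circle) : ℂ) • (g (zpow m) * b) := by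
  have hneg : b * g (zpow (-1)) = ((c ^ (-1 : ℤ) : Circle) : ℂ) • (g (zpow (-1)) * b) := by
    have h1 : g z * g (zpow (-1)) = 1 := by rw [z, ← map_mul, zpow_mul_zpow_neg, map_one]
    have h2 : g (zpow (-1)) * g z = 1 := by
      rw [z, ← map_mul, zpow_mul, neg_add_cancel, zpow_zero, map_one]
    have h3 : g (zpow (-1)) * b = (c : ℂ) • (b * g (zpow (-1))) := by
      calc g (zpow (-1)) * b = g (zpow (-1)) * (b * g z) * g (zpow (-1)) := by
            rw [mul_assoc, mul_assoc, h1, mul_one]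
        _ = (c : ℂ) • (b * g (zpow (-1))) := by
            rw [h, mul_smul_comm, smul_mul_assoc, ← mul_assoc, h2, one_mul]
    rw [h3, smul_smul]
    have : ((c ^ (-1 : ℤ) : Circle) : ℂ) * (c : ℂ) = 1 := by
      rw [← Circle.coe_mul, zpow_neg_one, inv_mul_cancel, Circle.coe_one]
    rw [this, one_smul]
  induction m with
  | zero => rw [zpow_zero, map_one, Circle.coe_zpow_zero, one_smul, mul_one, one_mul]
  | succ m ih =>
    rw [← zpow_mul, map_mul, ← mul_assoc, ih, smul_mul_assoc, mul_assoc, ← z, h, mul_smul_comm,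
      smul_smul, mul_assoc, zpow_add_one, Circle.coe_mul]
  | pred m ih =>
    rw [sub_eq_add_neg, ← zpow_mul, map_mul, ← mul_assoc, ih, smul_mul_assoc, mul_assoc, hneg,
      mul_smul_comm, smul_smul, mul_assoc, Circle.coe_zpow_mul_coe_zpow]

theorem map_zpow_of_map_z (g g' : CircleAlg →⋆ₐ[ℂ] D) {c : Circle} (h : g z = (c : ℂ) • g' z)
    (m : ℤ) : g (zpow m) = ((c ^ m : Circle) : ℂ) • g' (zpow m) := by
  have hneg : g (zpow (-1)) = ((c ^ (-1 : ℤ) : Circle) : ℂ) • g' (zpow (-1)) := by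
    rw [← star_zpow, map_star, ← z, h, star_smul, ← map_star]
    have := Circle.star_coe_zpow c 1
    rw [zpow_one] at this
    rw [this]
  induction m with
  | zero => rw [zpow_zero, map_one, map_one, Circle.coe_zpow_zero, one_smul]
  | succ m ih =>
    rw [← zpow_mul, map_mul, map_mul, ih, ← z, h, smul_mul_smul_comm, zpow_add_one, Circle.coe_mul]
  | pred m ih =>
    rw [sub_eq_add_neg, ← zpow_mul, map_mul, map_mul, ih, hneg, smul_mul_smul_comm,
      Circle.coe_zpow_mul_coe_zpow]

theorem comul_z : comul z = MinTensor.tmul z z := lift_z _ _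

theorem comul_zpow (m : ℤ) : comul (zpow m) = MinTensor.tmul (zpow m) (zpow m) := by
  have hneg : comul (zpow (-1)) = MinTensor.tmul (zpow (-1)) (zpow (-1)) := by
    rw [← star_zpow, map_star, ← z, comul_z, MinTensor.star_tmul]
  induction m with
  | zero => rw [zpow_zero, map_one, MinTensor.one_tmul_one]
  | succ m ih => rw [← zpow_mul, map_mul, ih, ← z, comul_z, MinTensor.tmul_mul]
  | pred m ih => rw [sub_eq_add_neg, ← zpow_mul, map_mul, ih, hneg, MinTensor.tmul_mul]

end CircleAlg

open CircleAlg MinTensor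

/-- The relation is raised to powers in one variable at a time; in between it is inverted to
exchange the roles of `U` and `V`. -/
theorem TorusAlg.ι₂_zpow_mul_ι₁_zpow (ζ : Circle) (k l : ℤ) :
    ι₂ ζ (zpow l) * ι₁ ζ (zpow k) =
      ((ζ ^ (k * l) : Circle) : ℂ) • (ι₁ ζ (zpow k) * ι₂ ζ (zpow l)) := by
  have h1 := mul_map_zpow (ι₁ ζ) (ι₂_z_mul_ι₁_z ζ) k
  have h2 : ι₁ ζ (zpow k) * ι₂ ζ z = ((ζ ^ (-k) : Circle) : ℂ) • (ι₂ ζ z * ι₁ ζ (zpow k)) := by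
    rw [h1, smul_smul, Circle.coe_zpow_mul_coe_zpow, neg_add_cancel, Circle.coe_zpow_zero, one_smul]
  have h3 := mul_map_zpow (ι₂ ζ) h2 l
  rw [h3, smul_smul, ← _root_.zpow_mul, Circle.coe_zpow_mul_coe_zpow, neg_mul, add_neg_cancel,
    Circle.coe_zpow_zero, one_smul]

/-! ### Braid relation, gauge maps, diagonal coaction and functoriality -/

namespace Braided

variable (ζ : Circle) {X Y : Type} [CStarAlgebra X] [CStarAlgebra Y]
  {ρX : X →⋆ₐ[ℂ] MinTensor X CircleAlg} {ρY : Y →⋆ₐ[ℂ] MinTensor Y CircleAlg}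

theorem j₂_mul_j₁ {x : X} {y : Y} {k l : ℤ} (hx : ρX x = tmul x (zpow k))
    (hy : ρY y = tmul y (zpow l)) :
    j₂ ζ ρX ρY y * j₁ ζ ρX ρY x =
      ((ζ ^ (k * l) : Circle) : ℂ) • (j₁ ζ ρX ρY x * j₂ ζ ρX ρY y) := by
  apply incl_injective ζ ρX ρY
  rw [map_smul, map_mul, map_mul, incl_j₁ ζ hx, incl_j₂ ζ hy, tmul_mul, tmul_mul, tmul_mul,
    tmul_mul, one_mul, one_mul, mul_one, mul_one, TorusAlg.ι₂_zpow_mul_ι₁_zpow, tmul_smul]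

/-- A homomorphism to the ambient algebra that sends generators into the closed subalgebra stays
inside it. Maps that exist already at the ambient level are obtained in this way, without norm
estimates. -/
theorem exists_restrict {C I : Type} [CStarAlgebra C] {e : I → C} (he : Generates e)
    (φ : C →⋆ₐ[ℂ] MinTensor (MinTensor X Y) (TorusAlg ζ)) (b : I → Braided ζ ρX ρY)
    (h : ∀ i, φ (e i) = incl ζ ρX ρY (b i)) :
    ∃ α : C →⋆ₐ[ℂ] Braided ζ ρX ρY, ∀ i, α (e i) = b i := by
  have hm (c : C) : φ c ∈ carrier ζ ρX ρY :=
    he.map_mem φ (StarSubalgebra.isClosed_topologicalClosure _) (fun i => by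
      rw [h]; exact (b i).2) c
  refine ⟨φ.codRestrict (carrier ζ ρX ρY) hm, fun i => ?_⟩
  exact incl_injective ζ ρX ρY (h i)

section Generators

variable {I J : Type} {x : I → X} {k : I → ℤ} {y : J → Y} {l : J → ℤ}

/-- Scaling both `U` and `V` by `w` preserves the torus relations. Applied to the last ambient leg,
this multiplies a generator of degree `m` by `w^m`; these maps are the slices of the diagonal
coaction. -/
theorem exists_gauge (hgx : Generates x) (hgy : Generates y)
    (hx : ∀ i, ρX (x i) = tmul (x i) (zpow (k i))) (hy : ∀ j, ρY (y j) = tmul (y j) (zpow (l j)))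
    (w : Circle) :
    ∃ α : Braided ζ ρX ρY →⋆ₐ[ℂ] Braided ζ ρX ρY,
      (∀ i, α (j₁ ζ ρX ρY (x i)) = ((w ^ k i : Circle) : ℂ) • j₁ ζ ρX ρY (x i)) ∧
        ∀ j, α (j₂ ζ ρX ρY (y j)) = ((w ^ l j : Circle) : ℂ) • j₂ ζ ρX ρY (y j) := by
  have hU {v : TorusAlg ζ} (hv : v ∈ unitary (TorusAlg ζ)) :
      (w : ℂ) • v ∈ unitary (TorusAlg ζ) := by
    have h1 : star (w : ℂ) * (w : ℂ) = 1 := by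
      simpa [Circle.coe_zpow_zero] using
        (congrArg (· * (w : ℂ)) (Circle.star_coe_zpow w 1))
    rw [Unitary.mem_iff, star_smul, smul_mul_smul_comm, smul_mul_smul_comm, h1, mul_comm, h1, hv.1,
      hv.2, one_smul]
    exact ⟨rfl, rfl⟩
  have hz₁ : TorusAlg.ι₁ ζ z ∈ unitary (TorusAlg ζ) := by
    rw [TorusAlg.ι₁_z]; exact TorusAlg.gen_mem_unitary ζ false
  have hz₂ : TorusAlg.ι₂ ζ z ∈ unitary (TorusAlg ζ) := by
    rw [TorusAlg.ι₂_z]; exact TorusAlg.gen_mem_unitary ζ true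
  have hc : ((w : ℂ) • TorusAlg.ι₂ ζ z) * ((w : ℂ) • TorusAlg.ι₁ ζ z) =
      (ζ : ℂ) • (((w : ℂ) • TorusAlg.ι₁ ζ z) * ((w : ℂ) • TorusAlg.ι₂ ζ z)) := by
    rw [smul_mul_smul_comm, smul_mul_smul_comm, TorusAlg.ι₂_z_mul_ι₁_z, smul_comm]
  let γ := TorusAlg.lift ζ _ _ (hU hz₁) (hU hz₂) hc
  have h₁ (m : ℤ) : γ (TorusAlg.ι₁ ζ (zpow m)) =
      ((w ^ m : Circle) : ℂ) • TorusAlg.ι₁ ζ (zpow m) :=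
    map_zpow_of_map_z (γ.comp (TorusAlg.ι₁ ζ)) (TorusAlg.ι₁ ζ) 
      (TorusAlg.lift_ι₁_z (hU hz₁) (hU hz₂) hc) m
  have h₂ (m : ℤ) : γ (TorusAlg.ι₂ ζ (zpow m)) =
      ((w ^ m : Circle) : ℂ) • TorusAlg.ι₂ ζ (zpow m) :=
    map_zpow_of_map_z (γ.comp (TorusAlg.ι₂ ζ)) (TorusAlg.ι₂ ζ) 
      (TorusAlg.lift_ι₂_z (hU hz₁) (hU hz₂) hc) m
  obtain ⟨α, hα⟩ := exists_restrict ζ (generates ζ ρX ρY hgx hgy)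
    ((MinTensor.map (StarAlgHom.id ℂ _) γ).comp (incl ζ ρX ρY))
    (Sum.elim (fun i => ((w ^ k i : Circle) : ℂ) • j₁ ζ ρX ρY (x i))
      fun j => ((w ^ l j : Circle) : ℂ) • j₂ ζ ρX ρY (y j)) (by
    rintro (i | j)
    · change MinTensor.map _ γ (incl ζ ρX ρY (j₁ ζ ρX ρY (x i))) =
        incl ζ ρX ρY (((w ^ k i : Circle) : ℂ) • j₁ ζ ρX ρY (x i))
      rw [map_smul, incl_j₁ ζ (hx i), map_tmul, h₁, tmul_smul]
      rfl
    · change MinTensor.map _ γ (incl ζ ρX ρY (j₂ ζ ρX ρY (y j))) =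
        incl ζ ρX ρY (((w ^ l j : Circle) : ℂ) • j₂ ζ ρX ρY (y j))
      rw [map_smul, incl_j₂ ζ (hy j), map_tmul, h₂, tmul_smul]
      rfl)
  exact ⟨α, fun i => hα (Sum.inl i), fun j => hα (Sum.inr j)⟩

/-- The diagonal coaction on a braided tensor product. -/
theorem exists_coaction (hgx : Generates x) (hgy : Generates y)
    (hx : ∀ i, ρX (x i) = tmul (x i) (zpow (k i))) (hy : ∀ j, ρY (y j) = tmul (y j) (zpow (l j))) :
    ∃ δ : Braided ζ ρX ρY →⋆ₐ[ℂ] MinTensor (Braided ζ ρX ρY) CircleAlg,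
      (∀ i, δ (j₁ ζ ρX ρY (x i)) = tmul (j₁ ζ ρX ρY (x i)) (zpow (k i))) ∧
        ∀ j, δ (j₂ ζ ρX ρY (y j)) = tmul (j₂ ζ ρX ρY (y j)) (zpow (l j)) := by
  choose s hs using fun w => exists_slice_right (hasNormingReps ζ ρX ρY)
    (StarAlgHom.id ℂ (Braided ζ ρX ρY)) (ev w)
  obtain ⟨δ, hδ⟩ := (generates ζ ρX ρY hgx hgy).exists_hom
    (Sum.elim (fun i => tmul (j₁ ζ ρX ρY (x i)) (zpow (k i)))
      fun j => tmul (j₂ ζ ρX ρY (y j)) (zpow (l j))) fun p => by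
    -- Evaluating the prospective coaction at `w` gives the gauge map of `w`, which is contractive;
    -- the slices control the norm in the tensor product with `C(𝕋)`.
    refine norm_le_of_slice _ s hs fun w => ?_
    obtain ⟨α, hα₁, hα₂⟩ := exists_gauge ζ hgx hgy hx hy w
    refine le_trans (le_of_eq ?_) (norm_starAlgHom_le α _)
    rw [FreeStar.map_eval, FreeStar.map_eval]
    congr 3
    ext g : 1
    obtain i | j := g
    · exact (hs w _ _).trans (hα₁ i).symm
    · exact (hs w _ _).trans (hα₂ j).symm
  exact ⟨δ, fun i => hδ (Sum.inl i), fun j => hδ (Sum.inr j)⟩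

/-- Functoriality of the braided tensor product for equivariant *-homomorphisms in the second
variable. -/
theorem exists_map {Y' : Type} [CStarAlgebra Y'] {ρY' : Y' →⋆ₐ[ℂ] MinTensor Y' CircleAlg}
    (hgx : Generates x) (hgy : Generates y)
    (hx : ∀ i, ρX (x i) = tmul (x i) (zpow (k i))) (hy : ∀ j, ρY (y j) = tmul (y j) (zpow (l j)))
    (f : Y →⋆ₐ[ℂ] Y') (hf : ∀ j, ρY' (f (y j)) = tmul (f (y j)) (zpow (l j))) :
    ∃ Θ : Braided ζ ρX ρY →⋆ₐ[ℂ] Braided ζ ρX ρY',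
      (∀ a, Θ (j₁ ζ ρX ρY a) = j₁ ζ ρX ρY' a) ∧ ∀ b, Θ (j₂ ζ ρX ρY b) = j₂ ζ ρX ρY' (f b) := by
  -- The ambient map is `id ⊗ f ⊗ id`. Since `f` preserves degrees, the power of `V` that
  -- accompanies `y j` is also the right one for `f (y j)`.
  obtain ⟨Θ, hΘ⟩ := exists_restrict ζ (generates ζ ρX ρY hgx hgy)
    ((MinTensor.map (MinTensor.map (StarAlgHom.id ℂ _) f) (StarAlgHom.id ℂ _)).comp
      (incl ζ ρX ρY))
    (Sum.elim (fun i => j₁ ζ ρX ρY' (x i)) fun j => j₂ ζ ρX ρY' (f (y j))) (by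
    rintro (i | j)
    · change MinTensor.map _ _ (incl ζ ρX ρY (j₁ ζ ρX ρY (x i))) =
        incl ζ ρX ρY' (j₁ ζ ρX ρY' (x i))
      rw [incl_j₁ ζ (hx i), incl_j₁ ζ (hx i), map_tmul, map_tmul, map_one]
      rfl
    · change MinTensor.map _ _ (incl ζ ρX ρY (j₂ ζ ρX ρY (y j))) =
        incl ζ ρX ρY' (j₂ ζ ρX ρY' (f (y j)))
      rw [incl_j₂ ζ (hy j), incl_j₂ ζ (hf j), map_tmul, map_tmul, map_one]
      rfl)
  exact ⟨Θ, DFunLike.congr_fun (hgx.hom_ext (φ := Θ.comp (j₁ ζ ρX ρY)) (ψ := j₁ ζ ρX ρY')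
      fun i => hΘ (Sum.inl i)),
    DFunLike.congr_fun (hgy.hom_ext (φ := Θ.comp (j₂ ζ ρX ρY)) (ψ := (j₂ ζ ρX ρY').comp f)
      fun j => hΘ (Sum.inr j))⟩

end Generators

end Braided

/-! ### The comultiplication of the bosonization -/

theorem Matrix.map_mem_unitary {n : ℕ} {D D' : Type} [CStarAlgebra D] [CStarAlgebra D']
    (φ : D →⋆ₐ[ℂ] D') {M : Matrix (Fin n) (Fin n) D} (hM : M ∈ unitary (Matrix (Fin n) (Fin n) D)) :
    M.map φ ∈ unitary (Matrix (Fin n) (Fin n) D') := by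
  refine ⟨sub_eq_zero.1 (Matrix.ext fun i j => ?_), sub_eq_zero.1 (Matrix.ext fun i j => ?_)⟩
  · rw [← AdmissibleMatrix.map_star_mul_self, hM.1, sub_self, Matrix.zero_apply, Matrix.zero_apply,
      map_zero]
  · rw [← AdmissibleMatrix.map_self_mul_star, hM.2, sub_self, Matrix.zero_apply, Matrix.zero_apply,
      map_zero]

namespace AdmissibleMatrix

variable {n : ℕ} (P : AdmissibleMatrix n) (ζ : Circle)

/-! ### Multiplicativity of the twisted conjugate -/

section Twist

variable {D : Type} [CStarAlgebra D]

theorem F_inv_mul_F : P.F⁻¹.1.map (algebraMap ℂ D) * P.F.1.map (algebraMap ℂ D) = 1 := by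
  rw [← Matrix.map_mul, Units.inv_mul, Matrix.map_one _ (map_zero _) (map_one _)]

theorem F_mul_F_inv : P.F.1.map (algebraMap ℂ D) * P.F⁻¹.1.map (algebraMap ℂ D) = 1 := by
  rw [← Matrix.map_mul, Units.mul_inv, Matrix.map_one _ (map_zero _) (map_one _)]

variable {P ζ}

/-- Reversing `star (b k j) * star (a i k)` costs the phase in `h`, and the exponents satisfy
`d_i(d_j - d_i) + (d_j - d_k)(d_k - d_i) = d_i(d_k - d_i) + d_k(d_j - d_k)`. This identity is the
reason for the phase in the definition of `ū_ζ`. -/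
theorem conj_mul {a b : Matrix (Fin n) (Fin n) D}
    (h : ∀ i k j, star (b k j) * star (a i k) =
      ((ζ ^ ((P.d j - P.d k) * (P.d k - P.d i)) : Circle) : ℂ) • (star (a i k) * star (b k j))) :
    P.conj ζ (a * b) = P.conj ζ a * P.conj ζ b := by
  ext i j
  simp only [conj, Matrix.of_apply, Matrix.mul_apply, star_sum, star_mul, Finset.smul_sum]
  refine Finset.sum_congr rfl fun k _ => ?_
  rw [h, smul_smul, smul_mul_smul_comm, Circle.coe_zpow_mul_coe_zpow,
    Circle.coe_zpow_mul_coe_zpow]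
  congr 3
  ring

theorem twist_mul {a b : Matrix (Fin n) (Fin n) D}
    (h : ∀ i k j, star (b k j) * star (a i k) =
      ((ζ ^ ((P.d j - P.d k) * (P.d k - P.d i)) : Circle) : ℂ) • (star (a i k) * star (b k j))) :
    P.twist ζ (a * b) = P.twist ζ a * P.twist ζ b := by
  rw [twist, twist, twist, conj_mul h]
  simp only [Matrix.mul_assoc]
  congr 2
  rw [← Matrix.mul_assoc (P.F⁻¹.1.map (algebraMap ℂ D)) (P.F.1.map (algebraMap ℂ D)), F_inv_mul_F,
    Matrix.one_mul]

end Twist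

/-- The degree of the generator `u_{ij}`. -/
abbrev deg (g : Fin n × Fin n) : ℤ := P.d g.2 - P.d g.1

theorem coaction_star_u (i j : Fin n) :
    P.coaction ζ (star (P.u ζ i j)) = tmul (star (P.u ζ i j)) (zpow (-(P.d j - P.d i))) := by
  rw [map_star, coaction_u, star_tmul, star_zpow]

/-- The candidate matrix is the product of `j₁(u)` and `j₂(u)`. It is unitary, and by `twist_mul`
its twist is the product of the images of the unitary `F ū_ζ F⁻¹`; the universal property of `A`
applies. -/
theorem exists_braided_comul : ∃ Δ : P.FreeUnitaryAlg ζ →⋆ₐ[ℂ] P.BraidedSquare ζ,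
    ∀ i j, Δ (P.u ζ i j) = ∑ k, Braided.j₁ ζ (P.coaction ζ) (P.coaction ζ) (P.u ζ i k) *
      Braided.j₂ ζ (P.coaction ζ) (P.coaction ζ) (P.u ζ k j) := by
  let j₁ := Braided.j₁ ζ (P.coaction ζ) (P.coaction ζ)
  let j₂ := Braided.j₂ ζ (P.coaction ζ) (P.coaction ζ)
  have htw : P.twist ζ ((P.u ζ).map j₁ * (P.u ζ).map j₂) =
      (P.twist ζ (P.u ζ)).map j₁ * (P.twist ζ (P.u ζ)).map j₂ := by
    rw [twist_mul, map_twist, map_twist]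
    intro i k j
    rw [Matrix.map_apply, Matrix.map_apply, ← map_star, ← map_star,
      Braided.j₂_mul_j₁ ζ (P.coaction_star_u ζ i k) (P.coaction_star_u ζ k j)]
    congr 3
    ring
  exact ⟨P.lift ζ ((P.u ζ).map j₁ * (P.u ζ).map j₂)
    (mul_mem (Matrix.map_mem_unitary j₁ (P.u_mem_unitary ζ))
      (Matrix.map_mem_unitary j₂ (P.u_mem_unitary ζ)))
    (htw ▸ mul_mem (Matrix.map_mem_unitary j₁ (P.twist_u_mem_unitary ζ))
      (Matrix.map_mem_unitary j₂ (P.twist_u_mem_unitary ζ))), fun i j =>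
    (P.lift_u ζ _ _ _ i j).trans (Matrix.mul_apply ..)⟩

theorem J₂_u_mul_J₁_zpow (i j : Fin n) (m : ℤ) :
    P.J₂ ζ (P.u ζ i j) * P.J₁ ζ (zpow m) =
      ((ζ ^ ((P.d j - P.d i) * m) : Circle) : ℂ) • (P.J₁ ζ (zpow m) * P.J₂ ζ (P.u ζ i j)) := by
  rw [Braided.j₂_mul_j₁ ζ (comul_zpow m) (P.coaction_u ζ i j), mul_comm m]

/-- The *-homomorphism `A ⊠_ζ A → B ⊗ B` that is the restriction of `ψ` to the second and third
leg. -/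
theorem exists_hom_square : ∃ θ : P.BraidedSquare ζ →⋆ₐ[ℂ]
      MinTensor (P.BosonizationAlg ζ) (P.BosonizationAlg ζ),
    (∀ a, θ (Braided.j₁ ζ (P.coaction ζ) (P.coaction ζ) a) =
      MinTensor.map (P.J₂ ζ) (P.J₁ ζ) (P.coaction ζ a)) ∧
    ∀ b, θ (Braided.j₂ ζ (P.coaction ζ) (P.coaction ζ) b) = tmul 1 (P.J₂ ζ b) := by
  obtain ⟨θ, h₁, h₂⟩ := Braided.exists_hom ζ (P.generates_u ζ) (P.generates_u ζ)
    (k := P.deg) (l := P.deg) (fun g => P.coaction_u ζ g.1 g.2) (fun g => P.coaction_u ζ g.1 g.2)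
    (hasNormingReps (P.BosonizationAlg ζ) (P.BosonizationAlg ζ))
    -- With `τ = j₂ ⊗ j₂` and the unitary `1 ⊗ j₁(z)`, a generator `a` of degree `k` in the first
    -- leg goes to `(j₂ a ⊗ 1)(1 ⊗ j₁(z^k))`, which is `(j₂ ⊗ j₁)ρ(a)`.
    (MinTensor.map (P.J₂ ζ) (P.J₂ ζ)) ((inr _ _).comp (P.J₁ ζ))
    (fun g m => by
      rw [StarAlgHom.comp_apply, inr_apply, map_tmul, map_one, Commute, SemiconjBy, tmul_mul,
        tmul_mul, one_mul, one_mul, mul_one, mul_one])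
    (fun g m => by
      rw [StarAlgHom.comp_apply, inr_apply, map_tmul, map_one, tmul_mul, tmul_mul,
        P.J₂_u_mul_J₁_zpow, one_mul, MinTensor.tmul_smul])
  refine ⟨θ, DFunLike.congr_fun ((P.generates_u ζ).hom_ext
    (φ := θ.comp (Braided.j₁ ζ (P.coaction ζ) (P.coaction ζ)))
    (ψ := (MinTensor.map (P.J₂ ζ) (P.J₁ ζ)).comp (P.coaction ζ)) fun g => ?_),
    DFunLike.congr_fun ((P.generates_u ζ).hom_ext
    (φ := θ.comp (Braided.j₂ ζ (P.coaction ζ) (P.coaction ζ)))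
    (ψ := (inr _ _).comp (P.J₂ ζ)) fun g => ?_)⟩
  · refine (h₁ g).trans ?_
    rw [StarAlgHom.comp_apply, StarAlgHom.comp_apply, inr_apply, map_tmul, map_one, tmul_mul,
      one_mul, mul_one, coaction_u, map_tmul]
  · refine (h₂ g).trans ?_
    rw [StarAlgHom.comp_apply, inr_apply, map_tmul, map_one]

theorem nonempty_bosonizationComul : Nonempty (P.BosonizationComul ζ) := by
  have hu (g : Fin n × Fin n) := P.coaction_u ζ g.1 g.2
  let k₁ := Braided.j₁ ζ (P.coaction ζ) (P.coaction ζ)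
  let k₂ := Braided.j₂ ζ (P.coaction ζ) (P.coaction ζ)
  obtain ⟨δ, hδ₁, hδ₂⟩ := Braided.exists_coaction ζ (P.generates_u ζ) (P.generates_u ζ)
    (k := P.deg) (l := P.deg) hu hu
  obtain ⟨Δ, hΔ⟩ := P.exists_braided_comul ζ
  have hz (i : Unit) : comul z = tmul z (zpow 1) := comul_z
  -- The degrees `d_k - d_i` and `d_j - d_k` add up to `d_j - d_i` for every summation index `k`.
  have hequiv (g : Fin n × Fin n) :
      δ (Δ (P.u ζ g.1 g.2)) = tmul (Δ (P.u ζ g.1 g.2)) (zpow (P.deg g)) := by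
    rw [hΔ, map_sum, sum_tmul]
    refine Finset.sum_congr rfl fun k _ => ?_
    rw [map_mul, hδ₁ (g.1, k), hδ₂ (k, g.2), tmul_mul, CircleAlg.zpow_mul]
    congr 2
    simp only [deg]
    ring
  obtain ⟨F, hF₁, hF₂⟩ := Braided.exists_map ζ generates_z (P.generates_u ζ) hz
    (l := P.deg) hu Δ hequiv
  obtain ⟨θ, hθ₁, hθ₂⟩ := P.exists_hom_square ζ
  let B := P.BosonizationAlg ζ
  -- Evaluation at `1` makes `τ(z ⊗ 1) = 1`, so the image of the first leg is carried entirely by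
  -- the unitary: `j₁(z) ↦ h(z) = j₁(z) ⊗ j₁(z)`.
  obtain ⟨τ, hτ⟩ := exists_slice_left (hasNormingReps B B) (ev 1) θ
  have hev : ev 1 z = 1 := by
    rw [ev_apply, z, zpow]
    simp
  have hτ₁ : τ (tmul z 1) = 1 := by rw [hτ, map_one, hev, one_smul]
  have hτ₂ (y) : τ (tmul 1 y) = θ y := by rw [hτ, map_one, one_smul]
  let h : CircleAlg →⋆ₐ[ℂ] MinTensor B B := (MinTensor.map (P.J₁ ζ) (P.J₁ ζ)).comp comul
  have hh (m : ℤ) : h (zpow m) = tmul (P.J₁ ζ (zpow m)) (P.J₁ ζ (zpow m)) := by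
    change MinTensor.map (P.J₁ ζ) (P.J₁ ζ) (comul (zpow m)) = _
    rw [comul_zpow, map_tmul]
  obtain ⟨ψ, hψ₁, hψ₂⟩ := Braided.exists_hom ζ (ρX := comul) (ρY := δ) generates_z
    (Braided.generates ζ (P.coaction ζ) (P.coaction ζ) (P.generates_u ζ) (P.generates_u ζ))
    (l := Sum.elim P.deg P.deg) hz (by
      rintro (g | g)
      · exact hδ₁ g
      · exact hδ₂ g) (hasNormingReps B B) τ h
    (fun _ m => by rw [hτ₁]; exact Commute.one_left _)
    (by
      -- The image of the second leg braids with `h(z^m)` only in the first tensor factor, as its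
      -- second factor lies in `j₁(C(𝕋))`; the image of the third leg braids only in the second
      -- factor.
      rintro (g | g) m
      · rw [hτ₂, hh, Sum.elim_inl, Sum.elim_inl, hθ₁, coaction_u, map_tmul, tmul_mul, tmul_mul,
          J₂_u_mul_J₁_zpow, MinTensor.smul_tmul, ← map_mul, ← map_mul, mul_comm (zpow m)]
      · rw [hτ₂, hh, Sum.elim_inr, Sum.elim_inr, hθ₂, tmul_mul, tmul_mul, J₂_u_mul_J₁_zpow,
          MinTensor.tmul_smul, one_mul, mul_one])
  refine ⟨{
    δ := δ
    δ_j₁ := DFunLike.congr_fun ((P.generates_u ζ).hom_ext (φ := δ.comp k₁)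
      (ψ := (MinTensor.map k₁ (StarAlgHom.id ℂ CircleAlg)).comp (P.coaction ζ)) fun g => ?_)
    δ_j₂ := DFunLike.congr_fun ((P.generates_u ζ).hom_ext (φ := δ.comp k₂)
      (ψ := (MinTensor.map k₂ (StarAlgHom.id ℂ CircleAlg)).comp (P.coaction ζ)) fun g => ?_)
    ΔG := Δ
    ΔG_u := hΔ
    idΔ := F
    idΔ_mul := fun x a => by rw [map_mul, hF₁, hF₂]
    ψ := ψ
    ψ_j₁ := DFunLike.congr_fun (generates_z.hom_ext (φ := ψ.comp (Braided.j₁ ζ comul δ))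
      (ψ := h) fun i => ?_)
    ψ_j₂ := DFunLike.congr_fun ((P.generates_u ζ).hom_ext
      (φ := (ψ.comp (Braided.j₂ ζ comul δ)).comp k₁)
      (ψ := (MinTensor.map (P.J₂ ζ) (P.J₁ ζ)).comp (P.coaction ζ)) fun g => ?_)
    ψ_j₃ := DFunLike.congr_fun ((P.generates_u ζ).hom_ext
      (φ := (ψ.comp (Braided.j₂ ζ comul δ)).comp k₂) (ψ := (inr _ _).comp (P.J₂ ζ)) fun g => ?_) }⟩
  · refine (hδ₁ g).trans ?_
    rw [StarAlgHom.comp_apply, coaction_u, map_tmul]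
    rfl
  · refine (hδ₂ g).trans ?_
    rw [StarAlgHom.comp_apply, coaction_u, map_tmul]
    rfl
  · refine (hψ₁ i).trans ?_
    rw [hτ₁, one_mul]
    rfl
  · exact (hψ₂ (Sum.inl g)).trans ((hτ₂ _).trans (hθ₁ _))
  · exact (hψ₂ (Sum.inr g)).trans ((hτ₂ _).trans (hθ₂ _))

end AdmissibleMatrix

/-! ### The bosonization as a compact matrix quantum group -/

theorem Matrix.isUnit_fromBlocks_diagonal {m n R : Type} [Fintype m] [Fintype n] [DecidableEq m]
    [DecidableEq n] [Ring R] {a : Matrix m m R} {d : Matrix n n R} (ha : IsUnit a)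
    (hd : IsUnit d) : IsUnit (Matrix.fromBlocks a 0 0 d) := by
  obtain ⟨a, rfl⟩ := ha
  obtain ⟨d, rfl⟩ := hd
  exact ⟨⟨Matrix.fromBlocks a.1 0 0 d.1, Matrix.fromBlocks a⁻¹.1 0 0 d⁻¹.1, by
    simp [Matrix.fromBlocks_multiply], by simp [Matrix.fromBlocks_multiply]⟩, rfl⟩

theorem isUnit_of_mem_unitary {R : Type} [Monoid R] [StarMul R] {a : R} (ha : a ∈ unitary R) :
    IsUnit a :=
  ⟨Unitary.toUnits ⟨a, ha⟩, rfl⟩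

namespace AdmissibleMatrix

variable {n : ℕ} (P : AdmissibleMatrix n) (ζ : Circle)

theorem diagonal_zpow_mem_unitary (c : Fin n → ℤ) :
    Matrix.diagonal (fun i => P.J₁ ζ (zpow (c i))) ∈
      unitary (Matrix (Fin n) (Fin n) (P.BosonizationAlg ζ)) := by
  have h (i) := Unitary.map_mem (P.J₁ ζ) (zpow_mem_unitary (c i))
  rw [Unitary.mem_iff, Matrix.star_eq_conjTranspose, Matrix.diagonal_conjTranspose,
    Matrix.diagonal_mul_diagonal, Matrix.diagonal_mul_diagonal, ← Matrix.diagonal_one]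
  exact ⟨congrArg _ (funext fun i => (h i).1), congrArg _ (funext fun i => (h i).2)⟩

theorem t_eq : P.t ζ = Matrix.diagonal (fun i => P.J₁ ζ (zpow (P.d i))) *
    (P.u ζ).map (P.J₂ ζ) := by
  ext i j
  rw [Matrix.diagonal_mul]
  rfl

theorem t_mem_unitary : P.t ζ ∈ unitary (Matrix (Fin n) (Fin n) (P.BosonizationAlg ζ)) := by
  rw [t_eq]
  exact mul_mem (P.diagonal_zpow_mem_unitary ζ P.d)
    (Matrix.map_mem_unitary _ (P.u_mem_unitary ζ))

/-- Moving `j₁(z^{-d_i})` to the left of `j₂(u_ij*)`, which has degree `d_i - d_j`, gives the phase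
`ζ^{d_i(d_j - d_i)}` of the twisted conjugate. -/
theorem map_star_t : (P.t ζ).map star = Matrix.diagonal (fun i => P.J₁ ζ (zpow (-P.d i))) *
    (P.conj ζ (P.u ζ)).map (P.J₂ ζ) := by
  ext i j
  rw [Matrix.diagonal_mul, Matrix.map_apply, Matrix.map_apply, t, Matrix.of_apply, star_mul,
    ← map_star, ← map_star, star_zpow,
    Braided.j₂_mul_j₁ ζ (comul_zpow (-P.d i)) (P.coaction_star_u ζ i j), conj, Matrix.of_apply,
    map_smul, mul_smul_comm]
  congr 3
  ring

/-- The relation makes `F ū_ζ F⁻¹` unitary, and conjugating by the invertible `F` preserves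
invertibility. -/
theorem isUnit_conj_u : IsUnit (P.conj ζ (P.u ζ)) := by
  let F : (Matrix (Fin n) (Fin n) (P.FreeUnitaryAlg ζ))ˣ :=
    ⟨P.F.1.map (algebraMap ℂ _), P.F⁻¹.1.map (algebraMap ℂ _), P.F_mul_F_inv, P.F_inv_mul_F⟩
  have h : F * P.conj ζ (P.u ζ) * F⁻¹.1 = P.twist ζ (P.u ζ) := rfl
  have h' := isUnit_of_mem_unitary (P.twist_u_mem_unitary ζ)
  rw [← h] at h'
  exact (Units.isUnit_units_mul F _).1 ((Units.isUnit_mul_units _ F⁻¹).1 h')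

theorem isUnit_map_star_t : IsUnit ((P.t ζ).map star) := by
  rw [map_star_t]
  refine (isUnit_of_mem_unitary (P.diagonal_zpow_mem_unitary ζ fun i => -P.d i)).mul ?_
  exact (P.isUnit_conj_u ζ).map (P.J₂ ζ).toAlgHom.toRingHom.mapMatrix

theorem isUnit_J₁_z : IsUnit (P.J₁ ζ z) :=
  (isUnit_of_mem_unitary (zpow_mem_unitary 1)).map (P.J₁ ζ)

theorem isUnit_matrix_unit {R : Type} [Ring R] {a : R} (ha : IsUnit a) :
    IsUnit (Matrix.of fun _ _ : Unit => a) := by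
  convert ha.map (Matrix.scalar Unit) using 1
  ext i j
  simp

theorem isUnit_zt : IsUnit (P.zt ζ) :=
  Matrix.isUnit_fromBlocks_diagonal (isUnit_matrix_unit (P.isUnit_J₁_z ζ))
    (isUnit_of_mem_unitary (P.t_mem_unitary ζ))

theorem isUnit_map_star_zt : IsUnit ((P.zt ζ).map star) := by
  rw [zt, Matrix.fromBlocks_map, Matrix.map_zero _ (star_zero _), Matrix.map_zero _ (star_zero _)]
  exact Matrix.isUnit_fromBlocks_diagonal (isUnit_matrix_unit (P.isUnit_J₁_z ζ).star)
    (P.isUnit_map_star_t ζ)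

/-- The entry `j₁(z)` generates `j₁(C(𝕋))`, which contains the factor `j₁(z^{-d_i})` needed to
recover `j₂(u_ij)` from `t_ij`. -/
theorem generates_zt :
    Generates fun p : (Unit ⊕ Fin n) × (Unit ⊕ Fin n) => P.zt ζ p.1 p.2 := by
  refine generates_of_forall_mem fun T hT h => ?_
  have hJ₁ (x : CircleAlg) : P.J₁ ζ x ∈ T :=
    generates_z.map_mem (P.J₁ ζ) hT (fun _ => h (Sum.inl (), Sum.inl ())) x
  refine (Braided.generates ζ comul (P.coaction ζ) generates_z (P.generates_u ζ)).mem hT ?_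
  rintro (_ | g)
  · exact hJ₁ z
  · have h1 : P.J₂ ζ (P.u ζ g.1 g.2) = P.J₁ ζ (zpow (-P.d g.1)) * P.t ζ g.1 g.2 := by
      rw [t, Matrix.of_apply, ← mul_assoc, ← map_mul, CircleAlg.zpow_mul, neg_add_cancel,
        CircleAlg.zpow_zero, map_one, one_mul]
    rw [Sum.elim_inr, h1]
    exact mul_mem (hJ₁ _) (h (Sum.inr g.1, Sum.inr g.2))

variable {P ζ}

namespace BosonizationComul

variable (𝔅 : P.BosonizationComul ζ)

theorem comul_J₁_zpow (m : ℤ) :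
    𝔅.comul (P.J₁ ζ (zpow m)) = tmul (P.J₁ ζ (zpow m)) (P.J₁ ζ (zpow m)) := by
  -- The axioms describe `idΔ` only on products; the value on the first leg is the case where the
  -- second factor is `1`.
  have h := 𝔅.idΔ_mul (zpow m) 1
  rw [map_one, map_one, map_one, mul_one, mul_one] at h
  rw [comul, StarAlgHom.comp_apply, h, 𝔅.ψ_j₁, comul_zpow, map_tmul]

/-- In the second tensor factor, `j₁(z^{d_i})` from the first leg meets `j₁(z^{d_k - d_i})` from the
coaction on `u_ik`. Their product is `j₁(z^{d_k})`, the factor that `t_kj` requires. -/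
theorem comul_t (i j : Fin n) : 𝔅.comul (P.t ζ i j) = ∑ k, tmul (P.t ζ i k) (P.t ζ k j) := by
  rw [t, Matrix.of_apply, comul, StarAlgHom.comp_apply, 𝔅.idΔ_mul, map_mul, 𝔅.ψ_j₁, comul_zpow,
    map_tmul, 𝔅.ΔG_u, map_sum, map_sum, Finset.mul_sum]
  refine Finset.sum_congr rfl fun k _ => ?_
  rw [map_mul, map_mul, 𝔅.ψ_j₂, 𝔅.ψ_j₃, coaction_u, map_tmul, tmul_mul, tmul_mul, mul_one,
    ← mul_assoc (P.J₁ ζ (zpow (P.d i))) (P.J₁ ζ (zpow (P.d k - P.d i))), ← map_mul,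
    CircleAlg.zpow_mul, add_sub_cancel]
  rfl

theorem comul_zt (i j : Unit ⊕ Fin n) :
    𝔅.comul (P.zt ζ i j) = ∑ k, tmul (P.zt ζ i k) (P.zt ζ k j) := by
  have h0 (a : P.BosonizationAlg ζ) : tmul a (0 : P.BosonizationAlg ζ) = 0 := by
    rw [tmul_eq, map_zero, mul_zero]
  rw [Fintype.sum_sum_type, Finset.univ_unique, Finset.sum_singleton, zt]
  obtain i | i := i <;> obtain j | j := j
  · simpa [h0, z] using 𝔅.comul_J₁_zpow 1
  · simp [h0, zero_tmul]
  · simp [h0, zero_tmul]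
  · simpa [h0] using 𝔅.comul_t i j

end BosonizationComul

end AdmissibleMatrix

end

theorem mainTheorem5 (n : ℕ) (P : AdmissibleMatrix n) (ζ : Circle) :
    Nonempty (P.BosonizationComul ζ) ∧ ∀ 𝔅 : P.BosonizationComul ζ,
      IsCompactMatrixQuantumGroup 𝔅.comul (P.zt ζ) ∧
      IsUnitaryRepresentation 𝔅.comul (P.t ζ) ∧
      (P.t ζ).map star =
        Matrix.diagonal (fun i => P.J₁ ζ (CircleAlg.zpow (-P.d i))) *
          (P.conj ζ (P.u ζ)).map (P.J₂ ζ) ∧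
      IsUnit ((P.t ζ).map star) := by
  refine ⟨P.nonempty_bosonizationComul ζ, fun 𝔅 => ⟨⟨P.generates_zt ζ, 𝔅.comul_zt, P.isUnit_zt ζ,
    P.isUnit_map_star_zt ζ⟩, ⟨P.t_mem_unitary ζ, 𝔅.comul_t⟩, P.map_star_t ζ, P.isUnit_map_star_t ζ⟩⟩
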